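/- Let $D\ge 3$. A \emph{curvature invariant} is a scalar that is a real linear combination of complete contractions (with $g^{ab}$) of products of the metric $g_{ab}$, the Riemann tensor $R_{abcd}$ and its covariant derivatives; it is \emph{of order $n$ without covariant derivatives} if every term contains exactly $n$ Riemann tensors and no covariant derivative of the curvature. An invariant $\mathcal L$ is \emph{reducible} (in dimension $D$) if it is a total derivative when evaluated on any Ricci-flat metric, i.e. if there are smooth functions $V^a$ of the metric components and finitely many of their partial derivatives such that $\sqrt{|g|}\,\mathcal L=\partial_a V^a$ for every Ricci-flat Lorentzian metric; otherwise it is \emph{irreducible}. Consider the static and spherically symmetric (SSS) ansatz $ds^2=-N(r)^2f(r)\,dt^2+dr^2/f(r)+r^2d\Omega^2_{(D-2)}$, and let $L_f=r^{D-2}\mathcal L|_{\rm SSS}$ with $N=1$. An invariant $\mathcal L$ is a \emph{generalized quasi-topological (GQTG) density} if the Euler--Lagrange expression of $L_f$ vanishes identically, $$\frac{\partial L_f}{\partial f}-\frac{d}{dr}\frac{\partial L_f}{\partial f'}+\frac{d^2}{dr^2}\frac{\partial L_f}{\partial f''}-\dots=0\quad\text{for all } f(r).$$ An invariant $\mathcal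 L$ is \emph{completable} if there is a GQTG density $\mathcal Q$ such that $\mathcal L-\mathcal Q$ is reducible. \textbf{Theorem.} Fix $D\ge 3$ and $n\ge 0$, and consider the set of all irreducible curvature invariants of order $n$ without covariant derivatives in dimension $D$. If one of these invariants is completable and does not vanish identically on the SSS ansatz (for all $N$, $f$), then all of these invariants are completable. -/

import Mathlib

open scoped ContDiff

noncomputable section

namespace HigherCurvature

/-! ### Pseudo-Riemannian geometry in a chart

`Chart D` is the coordinate space and a metric is given by its components `g x a b`. Everything
below is local, so that metrics on open subsets of the coordinate space are all that is needed. -/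

/-- The coordinate space of a `D`-dimensional chart. -/
abbrev Chart (D : ℕ) : Type := Fin D → ℝ

/-- Components `g x a b` of a rank two tensor field; used for metrics. -/
abbrev MetricField (D : ℕ) : Type := Chart D → Fin D → Fin D → ℝ

/-- Components of a covariant tensor field of rank `k`. -/
abbrev TensorField (D k : ℕ) : Type := Chart D → (Fin k → Fin D) → ℝ

variable {D : ℕ}

/-- The partial derivative `∂_a F`. -/
def partialD (a : Fin D) (F : Chart D → ℝ) (x : Chart D) : ℝ :=
  fderiv ℝ F x (Pi.single a 1)

/-- The inverse metric `g^{ab}`. -/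
def invMetric (g : MetricField D) (x : Chart D) (a b : Fin D) : ℝ :=
  (Matrix.of (g x))⁻¹ a b

/-- The Christoffel symbols `Γ^c_{ab}` of the Levi-Civita connection. -/
def christoffel (g : MetricField D) (x : Chart D) (c a b : Fin D) : ℝ :=
  (1 / 2) * ∑ e, invMetric g x c e *
    (partialD a (fun y => g y b e) x + partialD b (fun y => g y a e) x
      - partialD e (fun y => g y a b) x)

/-- The Riemann tensor `R^e_{bcd}`, with
`R^e_{bcd} = ∂_c Γ^e_{db} - ∂_d Γ^e_{cb} + Γ^e_{cp} Γ^p_{db} - Γ^e_{dp} Γ^p_{cb}`. -/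
def riemannUp (g : MetricField D) (x : Chart D) (e b c d : Fin D) : ℝ :=
  partialD c (fun y => christoffel g y e d b) x - partialD d (fun y => christoffel g y e c b) x
    + ∑ p, (christoffel g x e c p * christoffel g x p d b
      - christoffel g x e d p * christoffel g x p c b)

/-- The Riemann tensor `R_{abcd}` with all indices lowered. -/
def riemann (g : MetricField D) (x : Chart D) (a b c d : Fin D) : ℝ :=
  ∑ e, g x a e * riemannUp g x e b c d

/-- The Ricci tensor `R_{bd} = g^{ac} R_{abcd}`. -/
def ricci (g : MetricField D) (x : Chart D) (b d : Fin D) : ℝ :=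
  ∑ a, ∑ c, invMetric g x a c * riemann g x a b c d

/-- The covariant derivative of a covariant tensor field; the derivative index comes first. -/
def covDeriv (g : MetricField D) {k : ℕ} (T : TensorField D k) : TensorField D (k + 1) :=
  fun x idx =>
    partialD (idx 0) (fun y => T y (Fin.tail idx)) x
      - ∑ j : Fin k, ∑ c : Fin D,
          christoffel g x c (idx 0) (Fin.tail idx j) * T x (Function.update (Fin.tail idx) j c)

/-- A matrix of components is Lorentzian if it is congruent to `diag(-1, 1, …, 1)`. In particular
it is symmetric and invertible. -/
def IsLorentzian (A : Fin D → Fin D → ℝ) : Prop :=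
  ∃ P : Matrix (Fin D) (Fin D) ℝ, P.det ≠ 0 ∧
    Matrix.of A =
      P.transpose * Matrix.diagonal (fun i : Fin D => if i.val = 0 then (-1 : ℝ) else 1) * P

/-- `g` is a smooth Lorentzian Ricci-flat metric on the open set `U`. -/
structure IsRicciFlatMetric (U : Set (Chart D)) (g : MetricField D) : Prop where
  isOpen : IsOpen U
  smooth : ContDiffOn ℝ ∞ g U
  lorentzian : ∀ x ∈ U, IsLorentzian (g x)
  ricci_eq_zero : ∀ x ∈ U, ∀ a b, ricci g x a b = 0

/-! ### Curvature invariants -/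

/-- Covariant tensors of rank `k` polynomially built from the metric, the Riemann tensor and its
covariant derivatives: the linear combinations of partial contractions of products of
`g_{ab}` and `∇_{e₁} … ∇_{e_q} R_{abcd}`. -/
inductive CurvTensor : ℕ → Type
  /-- the metric `g_{ab}` -/
  | metric : CurvTensor 2
  /-- the Riemann tensor `R_{abcd}` -/
  | riem : CurvTensor 4
  /-- the covariant derivative -/
  | nabla {k : ℕ} (T : CurvTensor k) : CurvTensor (k + 1)
  /-- the tensor product -/
  | mul {k l : ℕ} (S : CurvTensor k) (T : CurvTensor l) : CurvTensor (k + l)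
  /-- a rearrangement of the indices -/
  | perm {k : ℕ} (σ : Equiv.Perm (Fin k)) (T : CurvTensor k) : CurvTensor k
  /-- the contraction of the first two indices with the inverse metric -/
  | contract {k : ℕ} (T : CurvTensor (k + 2)) : CurvTensor k
  /-- the sum -/
  | add {k : ℕ} (S T : CurvTensor k) : CurvTensor k
  /-- a real multiple -/
  | smul {k : ℕ} (c : ℝ) (T : CurvTensor k) : CurvTensor k

/-- A (parity preserving) curvature invariant is a curvature tensor of rank zero. -/
abbrev CurvInvariant : Type := CurvTensor 0

/-- The difference of two curvature tensors. -/
def CurvTensor.sub {k : ℕ} (S T : CurvTensor k) : CurvTensor k :=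
  CurvTensor.add S (CurvTensor.smul (-1) T)

/-- The tensor field obtained by evaluating a curvature tensor on a metric. -/
def CurvTensor.eval (g : MetricField D) : {k : ℕ} → CurvTensor k → TensorField D k
  | _, .metric => fun x idx => g x (idx 0) (idx 1)
  | _, .riem => fun x idx => riemann g x (idx 0) (idx 1) (idx 2) (idx 3)
  | _, .nabla T => covDeriv g (CurvTensor.eval g T)
  | _, .mul (k := k) (l := l) S T => fun x idx =>
      CurvTensor.eval g S x (fun i => idx (Fin.castAdd l i)) *
        CurvTensor.eval g T x (fun i => idx (Fin.natAdd k i))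
  | _, .perm σ T => fun x idx => CurvTensor.eval g T x (fun i => idx (σ i))
  | _, .contract T => fun x idx =>
      ∑ a, ∑ b, invMetric g x a b *
        CurvTensor.eval g T x (Matrix.vecCons a (Matrix.vecCons b idx))
  | _, .add S T => fun x idx => CurvTensor.eval g S x idx + CurvTensor.eval g T x idx
  | _, .smul c T => fun x idx => c * CurvTensor.eval g T x idx

/-- The value of a curvature invariant of the metric `g` at the point `x`. -/
def CurvTensor.value (L : CurvInvariant) (g : MetricField D) (x : Chart D) : ℝ :=
  CurvTensor.eval g L x ![]

/-- `T.IsOfOrder n`: every term of `T` contains exactly `n` Riemann tensors, any number of metrics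
and no covariant derivative. For invariants this is the order `n` in curvature, that is `2 n` in
derivatives of the metric, without covariant derivatives of the curvature. -/
def CurvTensor.IsOfOrder : {k : ℕ} → CurvTensor k → ℕ → Prop
  | _, .metric, n => n = 0
  | _, .riem, n => n = 1
  | _, .nabla _, _ => False
  | _, .mul S T, n => ∃ a b, a + b = n ∧ CurvTensor.IsOfOrder S a ∧ CurvTensor.IsOfOrder T b
  | _, .perm _ T, n => CurvTensor.IsOfOrder T n
  | _, .contract T, n => CurvTensor.IsOfOrder T n
  | _, .add S T, n => CurvTensor.IsOfOrder S n ∧ CurvTensor.IsOfOrder T n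
  | _, .smul _ T, n => CurvTensor.IsOfOrder T n

/-! ### Reducible invariants -/

/-- The space of `m`-jets of metrics at a point: values of `g, ∂g, …, ∂^m g`. -/
abbrev MetricJet (D m : ℕ) : Type :=
  (j : Fin (m + 1)) →
    ContinuousMultilinearMap ℝ (fun _ : Fin (j : ℕ) => Chart D) (Fin D → Fin D → ℝ)

/-- The `m`-jet of the metric `g` at the point `x`. -/
def metricJet (m : ℕ) (g : MetricField D) (x : Chart D) : MetricJet D m :=
  fun j => iteratedFDeriv ℝ (j : ℕ) g x

/-- An invariant is reducible in dimension `D` if it is a total derivative when evaluated on any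
Ricci-flat metric: there are local expressions `V^a`, smooth functions of the metric and finitely
many of its derivatives, with `√|g| L = ∂_a V^a` for all Ricci-flat metrics. -/
def IsReducible (D : ℕ) (L : CurvInvariant) : Prop :=
  ∃ (m : ℕ) (V : MetricJet D m → Fin D → ℝ),
    ContDiffOn ℝ ∞ V {J | IsLorentzian (J 0 0)} ∧
    ∀ (U : Set (Chart D)) (g : MetricField D), IsRicciFlatMetric U g →
      ∀ x ∈ U, Real.sqrt |(Matrix.of (g x)).det| * L.value g x =
        ∑ a, partialD a (fun y => V (metricJet m g y) a) x

/-- An invariant is irreducible in dimension `D` if it is not reducible. -/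
def IsIrreducible (D : ℕ) (L : CurvInvariant) : Prop := ¬ IsReducible D L

/-! ### Static and spherically symmetric metrics

The dimension is `D = d + 2`. The coordinates are `t = x 0`, `r = x 1` and stereographic
coordinates `y` of the unit sphere of dimension `d`, in which
`dΩ² = 4 (dy₁² + ⋯ + dy_d²) / (1 + |y|²)²`. -/

/-- The metric `-N(r)² f(r) dt² + dr² / f(r) + r² dΩ²` in dimension `d + 2`. -/
def sssMetric (d : ℕ) (N f : ℝ → ℝ) : MetricField (d + 2) :=
  fun x a b =>
    if a = b then
      Matrix.vecCons (-(N (x 1)) ^ 2 * f (x 1))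
        (Matrix.vecCons (1 / f (x 1))
          (fun _ : Fin d => (x 1) ^ 2 * (4 / (1 + ∑ j : Fin d, (x j.succ.succ) ^ 2) ^ 2))) a
    else 0

/-- The value `L|_SSS` as a function of `r`. It depends neither on the time nor on the point of the
sphere, by symmetry, and is computed at `t = 0`, `y = 0`. -/
def sssValue (d : ℕ) (L : CurvInvariant) (N f : ℝ → ℝ) (r : ℝ) : ℝ :=
  L.value (sssMetric d N f) (Matrix.vecCons 0 (Matrix.vecCons r (fun _ : Fin d => 0)))

/-- `h` is an admissible metric function (`N` or `f`) on the open set `I` of radii. -/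
structure IsRadialProfile (I : Set ℝ) (h : ℝ → ℝ) : Prop where
  isOpen : IsOpen I
  pos : ∀ r ∈ I, 0 < r
  smooth : ContDiffOn ℝ ∞ h I
  ne_zero : ∀ r ∈ I, h r ≠ 0

/-- The invariant vanishes identically on the static and spherically symmetric ansatz. -/
def VanishesOnSSS (d : ℕ) (L : CurvInvariant) : Prop :=
  ∀ (I : Set ℝ) (N f : ℝ → ℝ), IsRadialProfile I N → IsRadialProfile I f →
    ∀ r ∈ I, sssValue d L N f r = 0

/-- The jet `(h(r), h'(r), …, h^{(m)}(r))`. -/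
def radialJet (m : ℕ) (h : ℝ → ℝ) (r : ℝ) : Fin (m + 1) → ℝ :=
  fun j => iteratedDeriv (j : ℕ) h r

/-- The Euler-Lagrange expression `∑_j (-1)^j (d/dr)^j (∂ℓ/∂f^{(j)})` of the Lagrangian
`ℓ(r, f, f', …, f^{(m)})`, at the function `f` and the point `r`. -/
def eulerLagrange (m : ℕ) (ℓ : ℝ → (Fin (m + 1) → ℝ) → ℝ) (f : ℝ → ℝ) (r : ℝ) : ℝ :=
  ∑ j : Fin (m + 1), (-1 : ℝ) ^ (j : ℕ) *
    iteratedDeriv (j : ℕ) (fun s => fderiv ℝ (ℓ s) (radialJet m f s) (Pi.single j 1)) r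

/-- Generalized quasi-topological densities in dimension `d + 2`: the reduced Lagrangian
`L_f = r^d L|_SSS` at `N = 1`, as a function `ℓ` of `r, f, f', …, f^{(m)}` (which is unique where
`r > 0` and `f ≠ 0`), has an Euler-Lagrange expression that vanishes for all `f`. -/
def IsGQTG (d : ℕ) (Q : CurvInvariant) : Prop :=
  ∃ (m : ℕ) (ℓ : ℝ → (Fin (m + 1) → ℝ) → ℝ),
    ContDiffOn ℝ ∞ (fun p : ℝ × (Fin (m + 1) → ℝ) => ℓ p.1 p.2) {p | 0 < p.1 ∧ p.2 0 ≠ 0} ∧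
    ∀ (I : Set ℝ) (f : ℝ → ℝ), IsRadialProfile I f → ∀ r ∈ I,
      r ^ d * sssValue d Q (fun _ => 1) f r = ℓ r (radialJet m f r) ∧
      eulerLagrange m ℓ f r = 0

/-- An invariant is completable (to a generalized quasi-topological density) in dimension `d + 2`
if it differs from some such density by a reducible invariant. -/
def IsCompletable (d : ℕ) (L : CurvInvariant) : Prop :=
  ∃ Q : CurvInvariant, IsGQTG d Q ∧ IsReducible (d + 2) (CurvTensor.sub L Q)

end HigherCurvature

end

/-! A completing density can be written down at every order. Replacing each Riemann tensor of `L` by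
the Weyl tensor changes nothing on Ricci-flat metrics (`eval_substRiem`, `eval_weyl`). On the ansatz
with `N = 1` the curvature is diagonal on bivectors with three sectional values `A = -f''/2`, `B =
-f'/(2r)`, `p = (1-f)/r²`, and the Weyl tensor has one independent component `W = A - 2B + p`. Hence
the Weyl version of an `L` of order `n` reduces to `c W^n` by homogeneity (`realizes_weyl`), with `c
= weylCoeff d L`. It remains to add an invariant that vanishes on Ricci-flat metrics and turns `r^d
c W^n` into a total derivative in `r`, since total derivatives have zero Euler-Lagrange expression.

Let `R` be the Ricci scalar and `Z` the traceless Ricci component. The combination `R - 2W =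
(d+1)(4B + (d-2)p)` does not contain `f''`. For suitable constants, `r^d (R - 2W)^k (a W² + b Z² +
c' (R² + 2k R W))` is the total derivative of a function of `r, f, f'` (`fderiv_boundaryTerm`).
Modulo Ricci terms it is `a (-2)^k W^(k+2)`, where `a ≠ 0`, so a multiple of it completes `c
W^(k+2)`.

The Ricci terms must come from genuine invariants. Traces supply `R`, `W^j` for `j ≥ 2` and `Z²
W^j`, but the Weyl tensor is traceless and gives no `W` alone. The combination above avoids this
obstruction (`isRealized_mixed_scalar`, `isRicciRealized_density`).

The remaining cases are elementary: for `n = 0` the density is a constant, and `c = 0` for `n = 1`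
(`weylCoeff_of_order_one`) and for positive `n` in three dimensions (`weylCoeff_three_dim`). -/

open scoped ContDiff

noncomputable section

namespace HigherCurvature

variable {D : ℕ}

/-! ### Derivative-free invariants as algebraic functions of the frame curvature -/

namespace CurvTensor

/-- No covariant derivative occurs in the curvature tensor. -/
def NablaFree : {k : ℕ} → CurvTensor k → Prop
  | _, .metric => True
  | _, .riem => True
  | _, .nabla _ => False
  | _, .mul S T => NablaFree S ∧ NablaFree T
  | _, .perm _ T => NablaFree T
  | _, .contract T => NablaFree T
  | _, .add S T => NablaFree S ∧ NablaFree T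
  | _, .smul _ T => NablaFree T

theorem IsOfOrder.nablaFree {k : ℕ} {T : CurvTensor k} {n : ℕ} (h : T.IsOfOrder n) :
    T.NablaFree := by
  induction T generalizing n with
  | metric => trivial
  | riem => trivial
  | nabla T _ => exact h
  | mul S T hS hT =>
    obtain ⟨a, b, -, h₁, h₂⟩ := h
    exact ⟨hS h₁, hT h₂⟩
  | perm σ T hT => exact hT h
  | contract T hT => exact hT h
  | add S T hS hT => exact ⟨hS h.1, hT h.2⟩
  | smul c T hT => exact hT h

/-- The components of a derivative-free curvature tensor in an orthonormal frame, in which the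
metric is `δ_{ab}` and the Riemann tensor is `R a b c d`. -/
def frameEval (R : Fin D → Fin D → Fin D → Fin D → ℝ) :
    {k : ℕ} → CurvTensor k → (Fin k → Fin D) → ℝ
  | _, .metric => fun idx => if idx 0 = idx 1 then 1 else 0
  | _, .riem => fun idx => R (idx 0) (idx 1) (idx 2) (idx 3)
  | _, .nabla _ => fun _ => 0
  | _, .mul (k := k) (l := l) S T => fun idx =>
      frameEval R S (fun i => idx (Fin.castAdd l i)) *
        frameEval R T (fun i => idx (Fin.natAdd k i))
  | _, .perm σ T => fun idx => frameEval R T (fun i => idx (σ i))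
  | _, .contract T => fun idx =>
      ∑ a, frameEval R T (Matrix.vecCons a (Matrix.vecCons a idx))
  | _, .add S T => fun idx => frameEval R S idx + frameEval R T idx
  | _, .smul c T => fun idx => c * frameEval R T idx

/-- The frame is complex, with `s a` a square root of `g_aa`, so that a Lorentzian metric also
becomes `δ_ab`. Every lower index carries one factor `s`, and a contraction with `g^{ab}` removes
two of them. -/
theorem eval_eq_frameEval {k : ℕ} (T : CurvTensor k) (hT : T.NablaFree) (g : MetricField D)
    (x : Chart D) (s : Fin D → ℂ) (hs : ∀ a, s a ≠ 0)
    (hg : ∀ a b, (g x a b : ℂ) = if a = b then s a * s a else 0)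
    (R : Fin D → Fin D → Fin D → Fin D → ℝ)
    (hR : ∀ a b c d, (riemann g x a b c d : ℂ) = s a * s b * s c * s d * R a b c d)
    (idx : Fin k → Fin D) :
    (eval g T x idx : ℂ) = (∏ i, s (idx i)) * frameEval R T idx := by
  have hinv : ∀ a b, (invMetric g x a b : ℂ) = if a = b then (s a * s a)⁻¹ else 0 := by
    intro a b
    have hdiag : Matrix.of (g x) = Matrix.diagonal (fun a => g x a a) := by
      ext a b
      by_cases hab : a = b
      · subst hab; simp
      · have := hg a b
        rw [if_neg hab] at this
        simp only [Matrix.of_apply, Matrix.diagonal_apply_ne _ hab]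
        exact_mod_cast this
    unfold invMetric
    rw [hdiag, Matrix.inv_diagonal]
    by_cases hab : a = b
    · subst hab
      have h1 := hg a a
      rw [if_pos rfl] at h1
      have hne : ∀ a, g x a a ≠ 0 := by
        intro a h0
        have h2 := hg a a
        rw [if_pos rfl, h0] at h2
        simp [hs a] at h2
      have hu : IsUnit (fun a => g x a a) := by
        rw [Pi.isUnit_iff]
        exact fun a => (hne a).isUnit
      have : Ring.inverse (fun a => g x a a) a = (g x a a)⁻¹ := by
        obtain ⟨u, hu⟩ := hu
        rw [← hu, Ring.inverse_unit]
        have h3 : (u : Fin D → ℝ) a * (↑u⁻¹ : Fin D → ℝ) a = 1 := by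
          rw [← Pi.mul_apply, Units.mul_inv, Pi.one_apply]
        rw [← congrFun hu a]
        exact eq_inv_of_mul_eq_one_right h3
      rw [Matrix.diagonal_apply_eq, this]
      push_cast
      rw [h1]; simp
    · rw [Matrix.diagonal_apply_ne _ hab, if_neg hab]; simp
  induction T with
  | metric =>
    simp only [eval, frameEval, hg, Fin.prod_univ_two]
    split_ifs with h
    · simp [h]
    · simp
  | riem => simp [eval, frameEval, hR, Fin.prod_univ_four]
  | nabla T _ => exact hT.elim
  | mul S T hS hT' =>
    simp only [eval, frameEval, Complex.ofReal_mul, hS hT.1, hT' hT.2, Fin.prod_univ_add]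
    ring
  | perm σ T ih =>
    simp only [eval, frameEval, ih hT]
    rw [Equiv.prod_comp σ (fun i => s (idx i))]
  | contract T ih =>
    simp only [eval, frameEval, Complex.ofReal_sum, Complex.ofReal_mul, ih hT, hinv, ite_mul,
      zero_mul, Finset.sum_ite_eq, Finset.mem_univ, if_true, Fin.prod_univ_succ,
      Matrix.cons_val_zero, Matrix.cons_val_succ, Finset.mul_sum]
    refine Finset.sum_congr rfl fun a _ => ?_
    have := hs a
    field_simp
  | add S T hS hT' =>
    simp only [eval, frameEval, Complex.ofReal_add, hS hT.1, hT' hT.2]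
    ring
  | smul c T ih =>
    simp only [eval, frameEval, Complex.ofReal_mul, ih hT]
    ring

/-- Replace every Riemann tensor by the tensor `W`. -/
def substRiem (W : CurvTensor 4) : {k : ℕ} → CurvTensor k → CurvTensor k
  | _, .metric => .metric
  | _, .riem => W
  | _, .nabla T => .nabla (substRiem W T)
  | _, .mul S T => .mul (substRiem W S) (substRiem W T)
  | _, .perm σ T => .perm σ (substRiem W T)
  | _, .contract T => .contract (substRiem W T)
  | _, .add S T => .add (substRiem W S) (substRiem W T)
  | _, .smul c T => .smul c (substRiem W T)

theorem NablaFree.substRiem {W : CurvTensor 4} (hW : W.NablaFree) {k : ℕ} {T : CurvTensor k}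
    (hT : T.NablaFree) : (substRiem W T).NablaFree := by
  induction T with
  | metric => trivial
  | riem => exact hW
  | nabla T _ => exact hT
  | mul S T hS hT' => exact ⟨hS hT.1, hT' hT.2⟩
  | perm σ T ih => exact ih hT
  | contract T ih => exact ih hT
  | add S T hS hT' => exact ⟨hS hT.1, hT' hT.2⟩
  | smul c T ih => exact ih hT

theorem frameEval_substRiem (R : Fin D → Fin D → Fin D → Fin D → ℝ) (W : CurvTensor 4) {k : ℕ}
    (T : CurvTensor k) (idx : Fin k → Fin D) :
    frameEval R (substRiem W T) idx =
      frameEval (fun a b c d => frameEval R W ![a, b, c, d]) T idx := by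
  induction T with
  | metric => rfl
  | riem =>
    simp only [substRiem, frameEval]
    congr 1
    ext i; fin_cases i <;> rfl
  | nabla T _ => rfl
  | mul S T hS hT => simp only [substRiem, frameEval, hS, hT]
  | perm σ T ih => simp only [substRiem, frameEval, ih]
  | contract T ih => simp only [substRiem, frameEval, ih]
  | add S T hS hT => simp only [substRiem, frameEval, hS, hT]
  | smul c T ih => simp only [substRiem, frameEval, ih]

/-- Agreement of `W` with the Riemann tensor at the single point `x` suffices because no derivative
is taken. -/
theorem eval_substRiem {g : MetricField D} {x : Chart D} {W : CurvTensor 4}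
    (hW : ∀ idx, eval g W x idx = riemann g x (idx 0) (idx 1) (idx 2) (idx 3)) {k : ℕ}
    {T : CurvTensor k} (hT : T.NablaFree) (idx : Fin k → Fin D) :
    eval g (substRiem W T) x idx = eval g T x idx := by
  induction T with
  | metric => rfl
  | riem => exact hW idx
  | nabla T _ => exact hT.elim
  | mul S T hS hT' => simp only [substRiem, eval, hS hT.1, hT' hT.2]
  | perm σ T ih => simp only [substRiem, eval, ih hT]
  | contract T ih => simp only [substRiem, eval, ih hT]
  | add S T hS hT' => simp only [substRiem, eval, hS hT.1, hT' hT.2]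
  | smul c T ih => simp only [substRiem, eval, ih hT]

theorem frameEval_smul (c : ℝ) (R : Fin D → Fin D → Fin D → Fin D → ℝ) {k n : ℕ}
    {T : CurvTensor k} (hT : T.IsOfOrder n) (idx : Fin k → Fin D) :
    frameEval (fun a b e f => c * R a b e f) T idx = c ^ n * frameEval R T idx := by
  induction T generalizing n with
  | metric => rw [show n = 0 from hT]; simp [frameEval]
  | riem => rw [show n = 1 from hT]; simp [frameEval]
  | nabla T _ => exact hT.elim
  | mul S T hS hT' =>
    obtain ⟨a, b, rfl, h₁, h₂⟩ := hT
    simp only [frameEval, hS h₁, hT' h₂]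
    ring
  | perm σ T ih => simp only [frameEval, ih hT]
  | contract T ih => simp only [frameEval, ih hT, Finset.mul_sum]
  | add S T hS hT' => simp only [frameEval, hS hT.1, hT' hT.2]; ring
  | smul c T ih => simp only [frameEval, ih hT]; ring

theorem frameEval_of_order_zero (R R' : Fin D → Fin D → Fin D → Fin D → ℝ) {k : ℕ}
    {T : CurvTensor k} (hT : T.IsOfOrder 0) (idx : Fin k → Fin D) :
    frameEval R T idx = frameEval R' T idx := by
  -- Scaling the curvature by `0` has the weight `0 ^ 0 = 1`, so the value equals that at zero
  -- curvature, whatever `R` is.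
  have h := fun R : Fin D → Fin D → Fin D → Fin D → ℝ => frameEval_smul 0 R hT idx
  simp only [zero_mul, pow_zero, one_mul] at h
  rw [← h R, ← h R']

/-- A contraction of order one is linear in the curvature: in a product exactly one factor has order
one, and the other does not see the curvature at all. -/
theorem frameEval_sum {ι : Type*} (s : Finset ι)
    (R : ι → Fin D → Fin D → Fin D → Fin D → ℝ) {k : ℕ}
    {T : CurvTensor k} (hT : T.IsOfOrder 1) (idx : Fin k → Fin D) :
    frameEval (fun a b c d => ∑ i ∈ s, R i a b c d) T idx = ∑ i ∈ s, frameEval (R i) T idx := by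
  induction T with
  | metric => exact absurd hT (by simp [IsOfOrder])
  | riem => simp [frameEval]
  | nabla T _ => exact hT.elim
  | mul S T hS hT' =>
    obtain ⟨a, b, hab, h₁, h₂⟩ := hT
    rcases Nat.eq_zero_or_pos a with rfl | ha
    · obtain rfl : b = 1 := by omega
      simp only [frameEval, hT' h₂, Finset.mul_sum]
      exact Finset.sum_congr rfl fun i _ => by rw [frameEval_of_order_zero _ (R i) h₁]
    · obtain rfl : a = 1 := by omega
      obtain rfl : b = 0 := by omega
      simp only [frameEval, hS h₁, Finset.sum_mul]
      exact Finset.sum_congr rfl fun i _ => by rw [frameEval_of_order_zero _ (R i) h₂]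
  | perm σ T ih => simp only [frameEval, ih hT]
  | contract T ih => simp only [frameEval, ih hT]; exact Finset.sum_comm
  | add S T hS hT' => simp only [frameEval, hS hT.1, hT' hT.2, Finset.sum_add_distrib]
  | smul c T ih => simp only [frameEval, ih hT, Finset.mul_sum]

/-- Relabelling the vectors of an orthonormal frame is an isometry, so scalars do not change. This
allows averaging over permutations in `weylCoeff_of_order_one`. -/
theorem frameEval_perm (σ : Equiv.Perm (Fin D)) (R : Fin D → Fin D → Fin D → Fin D → ℝ) {k : ℕ}
    (T : CurvTensor k) (idx : Fin k → Fin D) :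
    frameEval (fun a b c d => R (σ a) (σ b) (σ c) (σ d)) T idx =
      frameEval R T (fun i => σ (idx i)) := by
  induction T with
  | metric => simp [frameEval]
  | riem => rfl
  | nabla T _ => rfl
  | mul S T hS hT => simp only [frameEval, hS, hT]
  | perm τ T ih => simp only [frameEval, ih]
  | contract T ih =>
    simp only [frameEval, ih]
    refine Fintype.sum_equiv σ _ _ fun a => ?_
    congr 1
    ext i
    refine Fin.cases rfl (fun i => ?_) i
    refine Fin.cases rfl (fun i => ?_) i
    rfl
  | add S T hS hT => simp only [frameEval, hS, hT]
  | smul c T ih => simp only [frameEval, ih]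

/-! ### Traces, Kulkarni-Nomizu products and compositions -/

/-- The trace `T_{abad}` of a rank four tensor. -/
def ric (T : CurvTensor 4) : CurvTensor 2 :=
  .contract (.perm ⟨![0, 2, 1, 3], ![0, 2, 1, 3], by decide, by decide⟩ T : CurvTensor (2 + 2))

/-- The Kulkarni-Nomizu product
`g_{ac} S_{bd} - g_{ad} S_{bc} - g_{bc} S_{ad} + g_{bd} S_{ac}`. -/
def kulkarni (S : CurvTensor 2) : CurvTensor 4 :=
  let T : CurvTensor 4 := .mul .metric S
  .add (sub (.perm ⟨![0, 2, 1, 3], ![0, 2, 1, 3], by decide, by decide⟩ T)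
      (.perm ⟨![0, 3, 1, 2], ![0, 2, 3, 1], by decide, by decide⟩ T))
    (sub (.perm ⟨![1, 3, 0, 2], ![2, 0, 3, 1], by decide, by decide⟩ T)
      (.perm ⟨![1, 2, 0, 3], ![2, 0, 1, 3], by decide, by decide⟩ T))

/-- The composition `S_{abcd} T_{cdef}` of rank four tensors. -/
def comp (S T : CurvTensor 4) : CurvTensor 4 :=
  .contract (k := 4) (.contract (k := 6)
    (.perm ⟨![4, 5, 0, 2, 1, 3, 6, 7], ![2, 4, 3, 5, 0, 1, 6, 7], by decide, by decide⟩
      (.mul S T : CurvTensor 8)))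

/-- The full trace `T_{abab}`. -/
def trace (T : CurvTensor 4) : CurvInvariant := .contract (ric T)

theorem frameEval_add (R : Fin D → Fin D → Fin D → Fin D → ℝ) {k : ℕ} (S T : CurvTensor k)
    (idx : Fin k → Fin D) :
    frameEval R (.add S T) idx = frameEval R S idx + frameEval R T idx := rfl

theorem frameEval_const_smul (R : Fin D → Fin D → Fin D → Fin D → ℝ) {k : ℕ} (c : ℝ)
    (T : CurvTensor k) (idx : Fin k → Fin D) :
    frameEval R (.smul c T) idx = c * frameEval R T idx := rfl

theorem frameEval_ric (R : Fin D → Fin D → Fin D → Fin D → ℝ) (T : CurvTensor 4) (b d : Fin D) :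
    frameEval R (ric T) ![b, d] = ∑ a, frameEval R T ![a, b, a, d] := by
  simp only [ric, frameEval]
  refine Finset.sum_congr rfl fun a _ => congrArg _ ?_
  ext i; fin_cases i <;> rfl

theorem frameEval_trace (R : Fin D → Fin D → Fin D → Fin D → ℝ) (T : CurvTensor 4) :
    frameEval R (trace T) ![] = ∑ b, ∑ a, frameEval R T ![a, b, a, b] := by
  simp only [trace, frameEval]
  exact Finset.sum_congr rfl fun b _ => frameEval_ric R T b b

/-- The two contractions prepend slots, which gives the index list `d, d, c, c, a, b, e, f`; the
permutation in `comp` distributes it as `a, b, d, c` and `d, c, e, f`. -/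
theorem frameEval_comp (R : Fin D → Fin D → Fin D → Fin D → ℝ) (S T : CurvTensor 4)
    (a b e f : Fin D) :
    frameEval R (comp S T) ![a, b, e, f] =
      ∑ c, ∑ d, frameEval R S ![a, b, d, c] * frameEval R T ![d, c, e, f] := by
  simp only [comp, frameEval]
  refine Finset.sum_congr rfl fun c _ => Finset.sum_congr rfl fun d _ => ?_
  congr 2 <;> (ext i; fin_cases i <;> rfl)

theorem frameEval_kulkarni (R : Fin D → Fin D → Fin D → Fin D → ℝ) (S : CurvTensor 2)
    (a b c d : Fin D) :
    frameEval R (kulkarni S) ![a, b, c, d] =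
      (if a = c then frameEval R S ![b, d] else 0) - (if a = d then frameEval R S ![b, c] else 0)
        - (if b = c then frameEval R S ![a, d] else 0)
        + (if b = d then frameEval R S ![a, c] else 0) := by
  have key : ∀ (σ : Equiv.Perm (Fin 4)) (p q u v : Fin D),
      (fun i => ![a, b, c, d] (σ i)) = ![p, q, u, v] →
      frameEval R (.perm σ (.mul .metric S : CurvTensor 4)) ![a, b, c, d] =
        if p = q then frameEval R S ![u, v] else 0 := by
    intro σ p q u v h
    have h' : ∀ i, ![a, b, c, d] (σ i) = ![p, q, u, v] i := fun i => congrFun h i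
    simp only [frameEval, h']
    rw [ite_mul, one_mul, zero_mul]
    have : (fun i : Fin 2 => ![p, q, u, v] (Fin.natAdd 2 i)) = ![u, v] := by
      ext i; fin_cases i <;> rfl
    simp only [this]
    rfl
  simp only [kulkarni, sub]
  rw [frameEval_add, frameEval_add, frameEval_add, frameEval_const_smul, frameEval_const_smul,
    key _ a c b d (by ext i; fin_cases i <;> rfl), key _ a d b c (by ext i; fin_cases i <;> rfl),
    key _ b d a c (by ext i; fin_cases i <;> rfl), key _ b c a d (by ext i; fin_cases i <;> rfl)]
  ring

/-! ### Tensors that are diagonal on bivectors -/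

/-- The components of a curvature-like tensor that is diagonal on bivectors. -/
def diagCurv (K : Fin D → Fin D → ℝ) (a b c d : Fin D) : ℝ :=
  K a b * ((if a = c then 1 else 0) * (if b = d then 1 else 0)
    - (if a = d then 1 else 0) * (if b = c then 1 else 0))

/-- `T` has the frame components `diagCurv K` if the Riemann tensor is `R`. -/
def HasDiag (R : Fin D → Fin D → Fin D → Fin D → ℝ) (T : CurvTensor 4) (K : Fin D → Fin D → ℝ) :
    Prop := ∀ a b c d, frameEval R T ![a, b, c, d] = diagCurv K a b c d

theorem hasDiag_riem (K : Fin D → Fin D → ℝ) : HasDiag (diagCurv K) .riem K :=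
  fun _ _ _ _ => rfl

theorem HasDiag.add {R : Fin D → Fin D → Fin D → Fin D → ℝ} {S T : CurvTensor 4}
    {K M : Fin D → Fin D → ℝ} (hS : HasDiag R S K) (hT : HasDiag R T M) :
    HasDiag R (.add S T) (fun a b => K a b + M a b) := by
  intro a b c d
  rw [frameEval_add, hS, hT]
  simp only [diagCurv]; ring

theorem HasDiag.smul {R : Fin D → Fin D → Fin D → Fin D → ℝ} {T : CurvTensor 4}
    {K : Fin D → Fin D → ℝ} (hT : HasDiag R T K) (r : ℝ) :
    HasDiag R (.smul r T) (fun a b => r * K a b) := by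
  intro a b c d
  rw [frameEval_const_smul, hT]
  simp only [diagCurv]; ring

/-- The antisymmetrizer in `diagCurv` vanishes for `a = b`, so the values of `K` on the diagonal
carry no information. -/
theorem HasDiag.congr {R : Fin D → Fin D → Fin D → Fin D → ℝ} {T : CurvTensor 4}
    {K M : Fin D → Fin D → ℝ} (hT : HasDiag R T K) (h : ∀ a b, a ≠ b → K a b = M a b) :
    HasDiag R T M := by
  intro a b c d
  rw [hT]
  simp only [diagCurv]
  by_cases hab : a = b
  · subst hab; ring
  · rw [h a b hab]

/-- Composition multiplies eigenvalues on bivectors. The factor 2 arises because the sum over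
ordered pairs meets each plane twice, and symmetry of `M` makes both contributions equal. -/
theorem HasDiag.comp {R : Fin D → Fin D → Fin D → Fin D → ℝ} {S T : CurvTensor 4}
    {K M : Fin D → Fin D → ℝ} (hS : HasDiag R S K) (hT : HasDiag R T M)
    (hM : ∀ a b, M a b = M b a) :
    HasDiag R (comp S T) (fun a b => 2 * (K a b * M a b)) := by
  intro a b e f
  rw [frameEval_comp]
  simp only [hS _ _ _ _, hT _ _ _ _, diagCurv]
  have aux : ∀ (c d : Fin D) (x y : ℝ), x * ((if a = d then (1 : ℝ) else 0) *
      (if b = c then 1 else 0) - (if a = c then 1 else 0) * (if b = d then 1 else 0)) * y =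
      (if a = d then (if b = c then x * y else 0) else 0) -
      (if b = d then (if a = c then x * y else 0) else 0) := by
    intro c d x y
    split_ifs <;> ring
  simp only [aux, Finset.sum_sub_distrib, Finset.sum_ite_eq, Finset.mem_univ, if_true]
  rw [hM b a]
  ring

theorem HasDiag.trace {R : Fin D → Fin D → Fin D → Fin D → ℝ} {T : CurvTensor 4}
    {K : Fin D → Fin D → ℝ} (hT : HasDiag R T K) (hK : ∀ a, K a a = 0) :
    frameEval R (trace T) ![] = ∑ b, ∑ a, K a b := by
  rw [frameEval_trace]
  refine Finset.sum_congr rfl fun b _ => Finset.sum_congr rfl fun a _ => ?_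
  rw [hT]
  simp only [diagCurv]
  by_cases h : a = b
  · subst h; simp [hK]
  · simp [h]

theorem HasDiag.ric {R : Fin D → Fin D → Fin D → Fin D → ℝ} {T : CurvTensor 4}
    {K : Fin D → Fin D → ℝ} (hT : HasDiag R T K) (hK : ∀ a, K a a = 0) (b d : Fin D) :
    frameEval R (ric T) ![b, d] = if b = d then ∑ a, K a b else 0 := by
  rw [frameEval_ric]
  by_cases hbd : b = d
  · subst hbd
    rw [if_pos rfl]
    refine Finset.sum_congr rfl fun a _ => ?_
    rw [hT]
    simp only [diagCurv]
    by_cases h : a = b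
    · subst h; simp [hK]
    · simp [h]
  · rw [if_neg hbd]
    refine Finset.sum_eq_zero fun a _ => ?_
    rw [hT]
    simp only [diagCurv]
    by_cases h : a = b
    · subst h; simp [hK]
    · have : ¬ b = a := fun h' => h h'.symm
      simp [hbd, this]

theorem hasDiag_kulkarni {R : Fin D → Fin D → Fin D → Fin D → ℝ} {S : CurvTensor 2}
    {s : Fin D → ℝ} (hS : ∀ a b, frameEval R S ![a, b] = if a = b then s a else 0) :
    HasDiag R (kulkarni S) (fun a b => s a + s b) := by
  intro a b c d
  rw [frameEval_kulkarni]
  simp only [hS, diagCurv]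
  by_cases h1 : a = c <;> by_cases h2 : b = d <;> by_cases h3 : a = d <;> by_cases h4 : b = c <;>
    simp [h1, h2, h3, h4] <;> grind

/-- The product of a scalar and the metric. -/
def scalarMetric (s : CurvInvariant) : CurvTensor 2 := .mul .metric s

theorem frameEval_scalarMetric (R : Fin D → Fin D → Fin D → Fin D → ℝ) (s : CurvInvariant)
    (a b : Fin D) :
    frameEval R (scalarMetric s) ![a, b] = if a = b then frameEval R s ![] else 0 := by
  simp only [scalarMetric, frameEval]
  have : (fun i : Fin 0 => ![a, b] (Fin.natAdd 2 i)) = ![] := Subsingleton.elim _ _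
  rw [this, ite_mul, one_mul, zero_mul]
  rfl

end CurvTensor

/-! ### Curvature of the static and spherically symmetric form -/

/-- The vector with the components `x` in the two directions `t, r` and `y` along the sphere. -/
def sssVec {d : ℕ} (x y : ℝ) (a : Fin (d + 2)) : ℝ := if a.val ≤ 1 then x else y

/-- The sectional components of a tensor with the symmetries of the static and spherically
symmetric ansatz: `A` in the `t`-`r` plane, `B` in the mixed planes, `p` along the sphere. -/
def sssCurv {d : ℕ} (A B p : ℝ) (a b : Fin (d + 2)) : ℝ :=
  if a = b then 0 else if a.val ≤ 1 then (if b.val ≤ 1 then A else B)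
    else (if b.val ≤ 1 then B else p)

theorem sssCurv_self {d : ℕ} (A B p : ℝ) (a : Fin (d + 2)) : sssCurv A B p a a = 0 := by
  simp [sssCurv]

theorem sssCurv_comm {d : ℕ} (A B p : ℝ) (a b : Fin (d + 2)) :
    sssCurv A B p a b = sssCurv A B p b a := by
  by_cases h : a = b
  · rw [h]
  · simp only [sssCurv, if_neg h, if_neg (Ne.symm h)]
    split_ifs <;> rfl

theorem sum_sssVec {d : ℕ} (x y : ℝ) : ∑ a : Fin (d + 2), sssVec x y a = 2 * x + d * y := by
  simp [Fin.sum_univ_succ, sssVec]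
  ring

/-- These are the Ricci eigenvalues: a direction in the `t`-`r` plane lies in one `A` plane and `d`
mixed planes, a direction on the sphere in two mixed planes and `d - 1` spherical ones. -/
theorem sum_sssCurv_left {d : ℕ} (A B p : ℝ) (b : Fin (d + 2)) :
    ∑ a, sssCurv A B p a b = sssVec (A + d * B) (2 * B + (d - 1) * p) b := by
  refine Fin.cases ?_ (fun b => ?_) b
  · rw [Fin.sum_univ_succ, Fin.sum_univ_succ, sssCurv_self]
    have h1 : sssCurv A B p (Fin.succ 0) (0 : Fin (d + 2)) = A := by simp [sssCurv]
    have h2 : ∀ i : Fin d, sssCurv A B p i.succ.succ 0 = B := fun i => by simp [sssCurv]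
    rw [h1]
    simp only [h2]
    simp [sssVec]
  refine Fin.cases ?_ (fun b => ?_) b
  · rw [Fin.sum_univ_succ, Fin.sum_univ_succ, sssCurv_self]
    have h1 : sssCurv A B p 0 (Fin.succ 0 : Fin (d + 2)) = A := by simp [sssCurv]
    have h2 : ∀ i : Fin d, sssCurv A B p i.succ.succ (Fin.succ 0) = B := fun i => by
      simp [sssCurv, Fin.ext_iff]
    rw [h1]
    simp only [h2]
    simp [sssVec]
  · rw [Fin.sum_univ_succ, Fin.sum_univ_succ]
    have h : ∀ i : Fin d, sssCurv A B p i.succ.succ b.succ.succ = p - if i = b then p else 0 := by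
      intro i
      by_cases hi : i = b <;> simp [sssCurv, hi]
    simp only [h, Finset.sum_sub_distrib, Finset.sum_ite_eq', Finset.mem_univ, if_true,
      Finset.sum_const, Finset.card_univ, Fintype.card_fin, nsmul_eq_mul]
    have h0 : sssCurv A B p 0 b.succ.succ = B := by
      simp [sssCurv, Fin.ext_iff]
    have h1 : sssCurv A B p (Fin.succ 0) b.succ.succ = B := by
      simp [sssCurv, Fin.ext_iff]
    have h2 : ∀ x y : ℝ, sssVec x y b.succ.succ = y := by
      intro x y
      simp [sssVec]
    rw [h0, h1, h2]
    ring

/-- The Ricci scalar of `sssCurv A B p`. -/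
def sssScalar (d : ℕ) (A B p : ℝ) : ℝ := 2 * A + 4 * d * B + d * (d - 1) * p

/-- The only component of the Weyl tensor of `sssCurv A B p`. -/
def sssWeyl (A B p : ℝ) : ℝ := A - 2 * B + p

/-- The only component of the traceless Ricci tensor of `sssCurv A B p`. -/
def sssTraceless (d : ℕ) (A B p : ℝ) : ℝ := A + (d - 2) * B - (d - 1) * p

theorem sum_sssCurv {d : ℕ} (A B p : ℝ) :
    ∑ b : Fin (d + 2), ∑ a, sssCurv A B p a b = sssScalar d A B p := by
  simp only [sum_sssCurv_left, sum_sssVec, sssScalar]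
  ring

/-! ### Weyl and traceless Ricci tensors on the ansatz -/

namespace CurvTensor

/-- The Weyl tensor in dimension `d + 2`. -/
def weyl (d : ℕ) : CurvTensor 4 :=
  .add .riem (.add (.smul (-1 / d) (kulkarni (ric .riem)))
    (.smul (1 / (2 * d * (d + 1))) (kulkarni (scalarMetric (trace .riem)))))

/-- The Kulkarni-Nomizu product of the metric and the traceless Ricci tensor in dimension
`d + 2`. -/
def tracelessRicci (d : ℕ) : CurvTensor 4 :=
  .add (kulkarni (ric .riem)) (.smul (-1 / (d + 2)) (kulkarni (scalarMetric (trace .riem))))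

theorem weyl_nablaFree (d : ℕ) : (weyl d).NablaFree := by
  simp [weyl, kulkarni, ric, scalarMetric, trace, sub, NablaFree]

theorem tracelessRicci_nablaFree (d : ℕ) : (tracelessRicci d).NablaFree := by
  simp [tracelessRicci, kulkarni, ric, scalarMetric, trace, sub, NablaFree]

section SSS

variable {d : ℕ} (A B p : ℝ)

theorem hasDiag_kulkarni_ric :
    HasDiag (diagCurv (sssCurv A B p)) (kulkarni (ric .riem)) (fun a b : Fin (d + 2) =>
      sssVec (A + d * B) (2 * B + (d - 1) * p) a + sssVec (A + d * B) (2 * B + (d - 1) * p) b) := by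
  refine hasDiag_kulkarni fun a b => ?_
  rw [(hasDiag_riem (sssCurv A B p)).ric (sssCurv_self A B p), sum_sssCurv_left]

theorem hasDiag_kulkarni_scalar :
    HasDiag (diagCurv (sssCurv A B p)) (kulkarni (scalarMetric (trace .riem)))
      (fun _ _ : Fin (d + 2) => sssScalar d A B p + sssScalar d A B p) := by
  refine hasDiag_kulkarni fun a b => ?_
  rw [frameEval_scalarMetric, (hasDiag_riem (sssCurv A B p)).trace (sssCurv_self A B p),
    sum_sssCurv]

/-- Vanishing traces `α + dβ = 0` and `2β + (d-1)γ = 0` fix the three weights up to scale, and the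
scale is set by `α - 2β + γ = 1`. -/
theorem hasDiag_weyl (hd : 1 ≤ d) :
    HasDiag (diagCurv (sssCurv A B p)) (weyl d) (fun a b : Fin (d + 2) => sssWeyl A B p *
      sssCurv ((d - 1) / (d + 1)) (-(d - 1) / (d * (d + 1))) (2 / (d * (d + 1))) a b) := by
  refine ((hasDiag_riem _).add (((hasDiag_kulkarni_ric A B p).smul _).add
    ((hasDiag_kulkarni_scalar A B p).smul _))).congr fun a b hab => ?_
  have h0 : (d : ℝ) ≠ 0 := by positivity
  have h1 : (d : ℝ) + 1 ≠ 0 := by positivity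
  simp only [sssCurv, sssVec, if_neg hab, sssScalar, sssWeyl]
  split_ifs <;> field_simp <;> ring

/-- The traceless Ricci tensor is proportional to `diag(d, d, -2, …, -2)`; the weights `2d`, `d -
2`, `-4` are the sums of two of these eigenvalues. -/
theorem hasDiag_tracelessRicci :
    HasDiag (diagCurv (sssCurv A B p)) (tracelessRicci d) (fun a b : Fin (d + 2) =>
      sssTraceless d A B p / (d + 2) * sssCurv (2 * d) (d - 2) (-4) a b) := by
  refine ((hasDiag_kulkarni_ric A B p).add
    ((hasDiag_kulkarni_scalar A B p).smul _)).congr fun a b hab => ?_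
  have h1 : (d : ℝ) + 2 ≠ 0 := by positivity
  simp only [sssCurv, sssVec, if_neg hab, sssScalar, sssTraceless]
  split_ifs <;> field_simp <;> ring

/-- The `(j + 1)`-th power of the Weyl tensor as an operator on bivectors. -/
def weylPow (d : ℕ) : ℕ → CurvTensor 4
  | 0 => weyl d
  | j + 1 => comp (weylPow d j) (weyl d)

theorem weylPow_nablaFree (d j : ℕ) : (weylPow d j).NablaFree := by
  induction j with
  | zero => exact weyl_nablaFree d
  | succ j ih => exact ⟨ih, weyl_nablaFree d⟩

theorem hasDiag_weylPow (hd : 1 ≤ d) (j : ℕ) :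
    HasDiag (diagCurv (sssCurv A B p)) (weylPow d j) (fun a b : Fin (d + 2) =>
      sssWeyl A B p ^ (j + 1) * sssCurv (2 ^ j * ((d - 1) / (d + 1)) ^ (j + 1))
        (2 ^ j * (-(d - 1) / (d * (d + 1))) ^ (j + 1)) (2 ^ j * (2 / (d * (d + 1))) ^ (j + 1))
        a b) := by
  induction j with
  | zero => simpa [weylPow] using hasDiag_weyl A B p hd
  | succ j ih =>
    refine (ih.comp (hasDiag_weyl A B p hd) fun a b => ?_).congr fun a b hab => ?_
    · rw [sssCurv_comm]
    · simp only [sssCurv, if_neg hab]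
      split_ifs <;> ring

end SSS

/-! ### Polynomials in the components that come from invariants -/

/-- On the static and spherically symmetric form of the curvature, `M` takes the value `f`. -/
structure Realizes (d : ℕ) (M : CurvInvariant) (f : ℝ → ℝ → ℝ → ℝ) : Prop where
  nablaFree : M.NablaFree
  frameEval_eq : ∀ A B p, frameEval (diagCurv (sssCurv (d := d) A B p)) M ![] = f A B p

/-- `M` vanishes wherever the Ricci tensor does. -/
def VanishesOnRicciFlat (d : ℕ) (M : CurvInvariant) : Prop :=
  ∀ (g : MetricField (d + 2)) (x : Chart (d + 2)), (∀ a b, ricci g x a b = 0) →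
    eval g M x ![] = 0

/-- Some derivative-free invariant takes the value `f`. -/
def IsRealized (d : ℕ) (f : ℝ → ℝ → ℝ → ℝ) : Prop := ∃ M, Realizes d M f

/-- Some derivative-free invariant that vanishes on Ricci-flat metrics takes the value `f`. -/
def IsRicciRealized (d : ℕ) (f : ℝ → ℝ → ℝ → ℝ) : Prop :=
  ∃ M, Realizes d M f ∧ VanishesOnRicciFlat d M

theorem Realizes.add {d : ℕ} {M N : CurvInvariant} {f h : ℝ → ℝ → ℝ → ℝ} (hM : Realizes d M f)
    (hN : Realizes d N h) : Realizes d (.add M N) (fun A B p => f A B p + h A B p) :=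
  ⟨⟨hM.1, hN.1⟩, fun A B p => by rw [frameEval_add, hM.2, hN.2]⟩

theorem Realizes.smul {d : ℕ} {M : CurvInvariant} {f : ℝ → ℝ → ℝ → ℝ} (hM : Realizes d M f)
    (c : ℝ) : Realizes d (.smul c M) (fun A B p => c * f A B p) :=
  ⟨hM.1, fun A B p => by rw [frameEval_const_smul, hM.2]⟩

theorem Realizes.mul {d : ℕ} {M N : CurvInvariant} {f h : ℝ → ℝ → ℝ → ℝ} (hM : Realizes d M f)
    (hN : Realizes d N h) :
    Realizes d (.mul M N : CurvTensor (0 + 0)) (fun A B p => f A B p * h A B p) :=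
  ⟨⟨hM.1, hN.1⟩, fun A B p => by
    rw [← hM.2, ← hN.2]
    exact congrArg₂ _ (congrArg _ (Subsingleton.elim _ _)) (congrArg _ (Subsingleton.elim _ _))⟩

theorem IsRealized.add {d : ℕ} {f h : ℝ → ℝ → ℝ → ℝ} (hf : IsRealized d f)
    (hh : IsRealized d h) : IsRealized d (fun A B p => f A B p + h A B p) :=
  let ⟨_, hM⟩ := hf
  let ⟨_, hN⟩ := hh
  ⟨_, hM.add hN⟩

theorem IsRealized.smul {d : ℕ} {f : ℝ → ℝ → ℝ → ℝ} (hf : IsRealized d f) (c : ℝ) :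
    IsRealized d (fun A B p => c * f A B p) :=
  let ⟨_, hM⟩ := hf
  ⟨_, hM.smul c⟩

theorem IsRealized.mul {d : ℕ} {f h : ℝ → ℝ → ℝ → ℝ} (hf : IsRealized d f)
    (hh : IsRealized d h) : IsRealized d (fun A B p => f A B p * h A B p) :=
  let ⟨_, hM⟩ := hf
  let ⟨_, hN⟩ := hh
  ⟨_, hM.mul hN⟩

theorem IsRicciRealized.isRealized {d : ℕ} {f : ℝ → ℝ → ℝ → ℝ} (hf : IsRicciRealized d f) :
    IsRealized d f :=
  let ⟨M, hM, _⟩ := hf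
  ⟨M, hM⟩

theorem IsRicciRealized.add {d : ℕ} {f h : ℝ → ℝ → ℝ → ℝ} (hf : IsRicciRealized d f)
    (hh : IsRicciRealized d h) : IsRicciRealized d (fun A B p => f A B p + h A B p) :=
  let ⟨_, hM, vM⟩ := hf
  let ⟨_, hN, vN⟩ := hh
  ⟨_, hM.add hN, fun g x hx => by simp only [eval, vM g x hx, vN g x hx, add_zero]⟩

theorem IsRicciRealized.smul {d : ℕ} {f : ℝ → ℝ → ℝ → ℝ} (hf : IsRicciRealized d f) (c : ℝ) :
    IsRicciRealized d (fun A B p => c * f A B p) :=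
  let ⟨_, hM, vM⟩ := hf
  ⟨_, hM.smul c, fun g x hx => by simp only [eval, vM g x hx, mul_zero]⟩

/-- The functions realized by Ricci-vanishing invariants form an ideal among all realized functions.
-/
theorem IsRicciRealized.mul {d : ℕ} {f h : ℝ → ℝ → ℝ → ℝ} (hf : IsRicciRealized d f)
    (hh : IsRealized d h) : IsRicciRealized d (fun A B p => f A B p * h A B p) :=
  let ⟨M, hM, vM⟩ := hf
  let ⟨_, hN⟩ := hh
  ⟨_, hM.mul hN, fun g x hx => by
    have h : ∀ idx : Fin 0 → Fin (d + 2), eval g M x idx = 0 := fun idx => by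
      rw [Subsingleton.elim idx ![]]; exact vM g x hx
    exact mul_eq_zero_of_left (h _) _⟩

theorem IsRealized.congr {d : ℕ} {f h : ℝ → ℝ → ℝ → ℝ} (hf : IsRealized d f)
    (e : ∀ A B p, f A B p = h A B p) : IsRealized d h := by
  have : f = h := by ext; exact e _ _ _
  rwa [← this]

theorem IsRicciRealized.congr {d : ℕ} {f h : ℝ → ℝ → ℝ → ℝ} (hf : IsRicciRealized d f)
    (e : ∀ A B p, f A B p = h A B p) : IsRicciRealized d h := by
  have : f = h := by ext; exact e _ _ _
  rwa [← this]

theorem eval_ric_riem {g : MetricField D} {x : Chart D} (hx : ∀ a b, ricci g x a b = 0)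
    (idx : Fin 2 → Fin D) : eval g (ric .riem) x idx = 0 := hx (idx 0) (idx 1)

theorem eval_trace_riem {g : MetricField D} {x : Chart D} (hx : ∀ a b, ricci g x a b = 0)
    (idx : Fin 0 → Fin D) : eval g (trace .riem) x idx = 0 := by
  simp only [trace, eval, eval_ric_riem hx, mul_zero, Finset.sum_const_zero]

theorem eval_kulkarni_eq_zero {g : MetricField D} {x : Chart D} {S : CurvTensor 2}
    (hS : ∀ idx, eval g S x idx = 0) (idx : Fin 4 → Fin D) : eval g (kulkarni S) x idx = 0 := by
  simp only [kulkarni, sub, eval, hS, mul_zero, add_zero]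

theorem eval_kulkarni_scalar {g : MetricField D} {x : Chart D} (hx : ∀ a b, ricci g x a b = 0)
    (idx : Fin 4 → Fin D) : eval g (kulkarni (scalarMetric (trace .riem))) x idx = 0 := by
  refine eval_kulkarni_eq_zero (fun idx => ?_) idx
  simp only [scalarMetric, eval, eval_trace_riem hx, mul_zero]

theorem eval_weyl {d : ℕ} {g : MetricField D} {x : Chart D} (hx : ∀ a b, ricci g x a b = 0)
    (idx : Fin 4 → Fin D) :
    eval g (weyl d) x idx = riemann g x (idx 0) (idx 1) (idx 2) (idx 3) := by
  simp only [weyl, eval, eval_kulkarni_scalar hx, eval_kulkarni_eq_zero (eval_ric_riem hx),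
    mul_zero, add_zero]

theorem eval_tracelessRicci {d : ℕ} {g : MetricField D} {x : Chart D}
    (hx : ∀ a b, ricci g x a b = 0) (idx : Fin 4 → Fin D) :
    eval g (tracelessRicci d) x idx = 0 := by
  simp only [tracelessRicci, eval, eval_kulkarni_scalar hx,
    eval_kulkarni_eq_zero (eval_ric_riem hx), mul_zero, add_zero]

theorem eval_comp_eq_zero {g : MetricField D} {x : Chart D} {S T : CurvTensor 4}
    (hS : ∀ idx, eval g S x idx = 0) (idx : Fin 4 → Fin D) : eval g (comp S T) x idx = 0 := by
  simp only [comp, eval, hS, zero_mul, mul_zero, Finset.sum_const_zero]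

theorem eval_trace_eq_zero {g : MetricField D} {x : Chart D} {T : CurvTensor 4}
    (hT : ∀ idx, eval g T x idx = 0) : eval g (trace T) x ![] = 0 := by
  simp only [trace, ric, eval, hT, mul_zero, Finset.sum_const_zero]

theorem isRicciRealized_scalar (d : ℕ) : IsRicciRealized d (sssScalar d) :=
  ⟨trace .riem, ⟨trivial, fun A B p => by
    rw [(hasDiag_riem _).trace (sssCurv_self A B p), sum_sssCurv]⟩,
    fun _ _ hx => eval_trace_riem hx _⟩

/-- Traces of powers of the Weyl weights must not vanish, although the mixed weight is negative. Its
modulus is `1/d` times that of the `t`-`r` weight, so under `huv` the mixed planes cannot outweigh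
the `t`-`r` plane; the spherical planes then make the sum strictly positive. -/
theorem weight_pos {d m : ℕ} (hd : 2 ≤ d) {u v c : ℝ} (hv : 0 ≤ v) (hc : 0 < c)
    (huv : 2 * d * v ≤ u * d ^ m) :
    0 < sssScalar d (u * ((d - 1) / (d + 1)) ^ m) (v * (-(d - 1) / (d * (d + 1))) ^ m)
      (c * (2 / (d * (d + 1))) ^ m) := by
  have hd' : (2 : ℝ) ≤ d := by exact_mod_cast hd
  have hα : 0 ≤ ((d : ℝ) - 1) / (d + 1) := div_nonneg (by linarith) (by linarith)
  set α := ((d : ℝ) - 1) / (d + 1) with hαdef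
  have hβ : -((d : ℝ) - 1) / (d * (d + 1)) = -(α / d) := by
    rw [hαdef]; field_simp
  have h1 : -(α ^ m / d ^ m) ≤ (-(α / d)) ^ m := by
    have := neg_abs_le ((-(α / d)) ^ m)
    rwa [abs_pow, abs_neg, abs_of_nonneg (by positivity), div_pow] at this
  have h2 : v * d * -(α ^ m / d ^ m) ≤ v * d * (-(α / d)) ^ m :=
    mul_le_mul_of_nonneg_left h1 (by positivity)
  have h3 : 2 * d * v * (α ^ m / d ^ m) ≤ u * α ^ m := by
    have := mul_le_mul_of_nonneg_right huv (show 0 ≤ α ^ m / (d : ℝ) ^ m by positivity)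
    have e : u * (d : ℝ) ^ m * (α ^ m / d ^ m) = u * α ^ m := by
      have : (d : ℝ) ^ m ≠ 0 := by positivity
      field_simp
    rwa [e] at this
  have h4 : 0 < (d : ℝ) * (d - 1) * (c * (2 / (d * (d + 1))) ^ m) := by
    have : 0 < (d : ℝ) - 1 := by linarith
    positivity
  rw [hβ]
  simp only [sssScalar]
  linarith

theorem IsRealized.of_const_mul {d : ℕ} {f : ℝ → ℝ → ℝ → ℝ} {c : ℝ} (hc : c ≠ 0)
    (h : IsRealized d fun A B p => c * f A B p) : IsRealized d f :=
  (h.smul c⁻¹).congr fun A B p => by rw [← mul_assoc, inv_mul_cancel₀ hc, one_mul]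

theorem IsRicciRealized.of_const_mul {d : ℕ} {f : ℝ → ℝ → ℝ → ℝ} {c : ℝ} (hc : c ≠ 0)
    (h : IsRicciRealized d fun A B p => c * f A B p) : IsRicciRealized d f :=
  (h.smul c⁻¹).congr fun A B p => by rw [← mul_assoc, inv_mul_cancel₀ hc, one_mul]

theorem trace_frameEval {d : ℕ} {T : CurvTensor 4} (hT : T.NablaFree)
    {f : ℝ → ℝ → ℝ → ℝ} {α β γ : ℝ}
    (h : ∀ A B p, HasDiag (diagCurv (sssCurv A B p)) T
      (fun a b : Fin (d + 2) => f A B p * sssCurv α β γ a b)) :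
    Realizes d (trace T) (fun A B p => sssScalar d α β γ * f A B p) :=
  ⟨hT, fun A B p => by
    rw [(h A B p).trace fun a => by rw [sssCurv_self, mul_zero]]
    simp only [← Finset.mul_sum, sum_sssCurv]
    ring⟩

/-- The trace of a power of the Weyl operator is a nonzero multiple of a power of `W`. The exponents
start at 2 because the Weyl tensor itself has trace zero. -/
theorem isRealized_weyl_pow {d : ℕ} (hd : 2 ≤ d) (j : ℕ) :
    IsRealized d (fun A B p => sssWeyl A B p ^ (j + 2)) := by
  have hd' : (2 : ℝ) ≤ d := by exact_mod_cast hd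
  refine IsRealized.of_const_mul (ne_of_gt ?_) ⟨_, trace_frameEval (weylPow_nablaFree d (j + 1))
    fun A B p => hasDiag_weylPow A B p (by omega) (j + 1)⟩
  refine weight_pos hd (by positivity) (by positivity) ?_
  have h1 : (1 : ℝ) ≤ (d : ℝ) ^ j := one_le_pow₀ (by linarith)
  have h2 : 2 * (d : ℝ) ≤ d ^ (j + 1 + 1) := by
    rw [pow_succ, pow_succ]
    nlinarith [mul_le_mul_of_nonneg_right h1 (show (0 : ℝ) ≤ d * d by positivity)]
  have h3 : (0 : ℝ) ≤ 2 ^ (j + 1) := by positivity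
  nlinarith

theorem isRicciRealized_traceless_sq_mul_weyl_pow {d : ℕ} (hd : 2 ≤ d) (j : ℕ) :
    IsRicciRealized d (fun A B p => sssTraceless d A B p ^ 2 * sssWeyl A B p ^ j) := by
  have hd' : (2 : ℝ) ≤ d := by exact_mod_cast hd
  have hd2 : (d : ℝ) + 2 ≠ 0 := by positivity
  have hcomm : ∀ x y A B p (a b : Fin (d + 2)),
      x / y * sssCurv A B p a b = x / y * sssCurv A B p b a := fun x y A B p a b => by
    rw [sssCurv_comm]
  have hsq : ∀ A B p, HasDiag (diagCurv (sssCurv A B p))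
      (comp (tracelessRicci d) (tracelessRicci d)) (fun a b : Fin (d + 2) =>
        sssTraceless d A B p ^ 2 * sssWeyl A B p ^ 0 * sssCurv (2 / (d + 2) ^ 2 * (2 * d) ^ 2)
          (2 / (d + 2) ^ 2 * (d - 2) ^ 2) (2 / (d + 2) ^ 2 * 16) a b) := fun A B p =>
    ((hasDiag_tracelessRicci A B p).comp (hasDiag_tracelessRicci A B p) (hcomm _ _ _ _ _)).congr
      fun a b hab => by
        simp only [sssCurv, if_neg hab]
        split_ifs <;> field_simp <;> ring
  have hfree : (comp (tracelessRicci d) (tracelessRicci d)).NablaFree :=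
    ⟨tracelessRicci_nablaFree d, tracelessRicci_nablaFree d⟩
  -- `weylPow d j` is the power `j + 1`, so the case without a Weyl factor is separate.
  rcases j with _ | j
  · refine IsRicciRealized.of_const_mul (ne_of_gt ?_) ⟨_, trace_frameEval hfree hsq,
      fun g x hx => eval_trace_eq_zero (eval_comp_eq_zero (eval_tracelessRicci hx))⟩
    have : 0 ≤ (d : ℝ) - 1 := by linarith
    simp only [sssScalar]
    positivity
  · have hall : ∀ A B p, HasDiag (diagCurv (sssCurv A B p))
        (comp (comp (tracelessRicci d) (tracelessRicci d)) (weylPow d j))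
        (fun a b : Fin (d + 2) =>
        sssTraceless d A B p ^ 2 * sssWeyl A B p ^ (j + 1) * sssCurv
          (2 * (2 / (d + 2) ^ 2 * (2 * d) ^ 2) * 2 ^ j * ((d - 1) / (d + 1)) ^ (j + 1))
          (2 * (2 / (d + 2) ^ 2 * (d - 2) ^ 2) * 2 ^ j * (-(d - 1) / (d * (d + 1))) ^ (j + 1))
          (2 * (2 / (d + 2) ^ 2 * 16) * 2 ^ j * (2 / (d * (d + 1))) ^ (j + 1)) a b) :=
      fun A B p => ((hsq A B p).comp (hasDiag_weylPow A B p (by omega) j) fun a b => by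
        rw [sssCurv_comm]).congr fun a b hab => by
          simp only [sssCurv, if_neg hab]
          split_ifs <;> ring
    refine IsRicciRealized.of_const_mul (ne_of_gt ?_) ⟨_, trace_frameEval
      (T := comp (comp (tracelessRicci d) (tracelessRicci d)) (weylPow d j))
      ⟨hfree, weylPow_nablaFree d j⟩ hall, fun g x hx =>
        eval_trace_eq_zero (eval_comp_eq_zero (eval_comp_eq_zero (eval_tracelessRicci hx)))⟩
    refine weight_pos hd (by positivity) (by positivity) ?_
    have h1 : (1 : ℝ) ≤ (d : ℝ) ^ j := one_le_pow₀ (by linarith)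
    have h2 : 2 * d * ((d : ℝ) - 2) ^ 2 ≤ (2 * d) ^ 2 * d ^ (j + 1) := by
      rw [pow_succ _ j]
      have : (2 * (d : ℝ)) ^ 2 * d * 1 ≤ (2 * d) ^ 2 * d * d ^ j :=
        mul_le_mul_of_nonneg_left h1 (by positivity)
      have h4 : ((d : ℝ) - 2) ^ 2 ≤ d ^ 2 := pow_le_pow_left₀ (by linarith) (by linarith) 2
      have h5 := mul_le_mul_of_nonneg_left h4 (show (0 : ℝ) ≤ 2 * d by positivity)
      have h6 : (0 : ℝ) ≤ d ^ 3 := by positivity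
      linarith
    have h3 := mul_le_mul_of_nonneg_left h2
      (show (0 : ℝ) ≤ 2 * (2 / (d + 2) ^ 2) * 2 ^ j by positivity)
    calc _ = 2 * (2 / ((d : ℝ) + 2) ^ 2) * 2 ^ j * (2 * d * ((d : ℝ) - 2) ^ 2) := by ring
      _ ≤ _ := h3
      _ = _ := by ring

/-- Expanding one factor `R - 2W` at a time never lowers the exponent of `W` below 2. -/
theorem isRealized_mixed {d : ℕ} (hd : 2 ≤ d) (k j : ℕ) : IsRealized d (fun A B p =>
    (sssScalar d A B p - 2 * sssWeyl A B p) ^ k * sssWeyl A B p ^ (j + 2)) := by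
  induction k generalizing j with
  | zero => simpa using isRealized_weyl_pow hd j
  | succ k ih =>
    exact (((isRicciRealized_scalar d).isRealized.mul (ih j)).add ((ih (j + 1)).smul (-2))).congr
      fun A B p => by ring

/-- Modulo `R` the factor `R - 2W` is `-2W`; the difference is a multiple of `R` by a realized
function. -/
theorem isRicciRealized_mixed {d : ℕ} (hd : 2 ≤ d) (k j : ℕ) : IsRicciRealized d (fun A B p =>
    (sssScalar d A B p - 2 * sssWeyl A B p) ^ k * sssWeyl A B p ^ (j + 2)
      - (-2) ^ k * sssWeyl A B p ^ (k + j + 2)) := by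
  induction k generalizing j with
  | zero =>
    exact ((isRicciRealized_scalar d).smul 0).congr fun A B p => by
      rw [zero_add]; ring
  | succ k ih =>
    exact (((isRicciRealized_scalar d).mul (isRealized_mixed hd k j)).add
      ((ih (j + 1)).smul (-2))).congr fun A B p => by ring

theorem isRicciRealized_mixed_traceless {d : ℕ} (hd : 2 ≤ d) (k j : ℕ) : IsRicciRealized d (fun A B p =>
    (sssScalar d A B p - 2 * sssWeyl A B p) ^ k *
      (sssTraceless d A B p ^ 2 * sssWeyl A B p ^ j)) := by
  induction k generalizing j with
  | zero => simpa using isRicciRealized_traceless_sq_mul_weyl_pow hd j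
  | succ k ih =>
    exact (((isRicciRealized_scalar d).mul (ih j).isRealized).add
      ((ih (j + 1)).smul (-2))).congr fun A B p => by ring

/-- The term linear in `W` cancels: `(R - 2W)^k` contributes `-2k R^k W` and the last factor `+2k
R^k W`. Only pure powers of `R` and terms with `W` to the power at least 2 remain. The induction
uses `(R - 2W)(R + 2(k+1)W) = R(R + 2kW) - 4(k+1)W²`. -/
theorem isRealized_mixed_scalar {d : ℕ} (hd : 2 ≤ d) (k : ℕ) : IsRealized d (fun A B p =>
    (sssScalar d A B p - 2 * sssWeyl A B p) ^ k *
      (sssScalar d A B p + 2 * k * sssWeyl A B p)) := by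
  induction k with
  | zero => simpa using (isRicciRealized_scalar d).isRealized
  | succ k ih =>
    refine (((isRicciRealized_scalar d).isRealized.mul ih).add
      ((isRealized_mixed hd k 0).smul (-4 * (k + 1)))).congr fun A B p => ?_
    push_cast
    ring

/-- The density of order `k + 2` whose reduced Lagrangian is a total derivative, up to the term
that involves only the Weyl tensor. -/
theorem isRicciRealized_density {d : ℕ} (hd : 2 ≤ d) (k : ℕ) (a b c : ℝ) : IsRicciRealized d (fun A B p =>
    (sssScalar d A B p - 2 * sssWeyl A B p) ^ k * (a * sssWeyl A B p ^ 2
      + b * sssTraceless d A B p ^ 2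
      + c * (sssScalar d A B p ^ 2 + 2 * k * sssScalar d A B p * sssWeyl A B p))
      - a * (-2) ^ k * sssWeyl A B p ^ (k + 2)) :=
  ((((isRicciRealized_mixed hd k 0).smul a).add
    ((isRicciRealized_mixed_traceless hd k 0).smul b)).add
      (((isRicciRealized_scalar d).mul (isRealized_mixed_scalar hd k)).smul c)).congr
    fun A B p => by rw [add_zero]; ring

end CurvTensor

/-! ### Partial derivatives -/

theorem partialD_congr {a : Fin D} {F G : Chart D → ℝ} {x : Chart D} (h : F =ᶠ[nhds x] G) :
    partialD a F x = partialD a G x := by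
  rw [partialD, partialD, h.fderiv_eq]

theorem partialD_const (a : Fin D) (c : ℝ) (x : Chart D) : partialD a (fun _ => c) x = 0 := by
  simp [partialD]

theorem partialD_add {a : Fin D} {F G : Chart D → ℝ} {x : Chart D} (hF : DifferentiableAt ℝ F x)
    (hG : DifferentiableAt ℝ G x) :
    partialD a (fun y => F y + G y) x = partialD a F x + partialD a G x := by
  simp only [partialD]
  rw [show (fun y => F y + G y) = F + G from rfl, fderiv_add hF hG]
  rfl

theorem partialD_sub {a : Fin D} {F G : Chart D → ℝ} {x : Chart D} (hF : DifferentiableAt ℝ F x)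
    (hG : DifferentiableAt ℝ G x) :
    partialD a (fun y => F y - G y) x = partialD a F x - partialD a G x := by
  simp only [partialD]
  rw [show (fun y => F y - G y) = F - G from rfl, fderiv_sub hF hG]
  rfl

theorem partialD_mul {a : Fin D} {F G : Chart D → ℝ} {x : Chart D} (hF : DifferentiableAt ℝ F x)
    (hG : DifferentiableAt ℝ G x) :
    partialD a (fun y => F y * G y) x = partialD a F x * G x + F x * partialD a G x := by
  simp only [partialD]
  rw [show (fun y => F y * G y) = F * G from rfl, fderiv_mul hF hG]
  simp
  ring

theorem partialD_comp {a : Fin D} {φ : ℝ → ℝ} {F : Chart D → ℝ} {x : Chart D}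
    (hφ : DifferentiableAt ℝ φ (F x)) (hF : DifferentiableAt ℝ F x) :
    partialD a (fun y => φ (F y)) x = deriv φ (F x) * partialD a F x := by
  simp only [partialD]
  rw [show (fun y => φ (F y)) = φ ∘ F from rfl, fderiv_comp x hφ hF]
  simp [mul_comm]

theorem partialD_apply (a b : Fin D) (x : Chart D) :
    partialD a (fun y => y b) x = if a = b then 1 else 0 := by
  have : HasFDerivAt (fun y : Chart D => y b)
      (ContinuousLinearMap.proj (R := ℝ) (φ := fun _ : Fin D => ℝ) b) x := hasFDerivAt_apply b x
  rw [partialD, this.fderiv]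
  simp [Pi.single_apply, eq_comm]

theorem partialD_ite (p : Prop) [Decidable p] (a : Fin D) (F : Chart D → ℝ) (x : Chart D) :
    partialD a (fun y => if p then F y else 0) x = if p then partialD a F x else 0 := by
  split_ifs
  · rfl
  · exact partialD_const a 0 x

/-! ### The curvature of a diagonal metric -/

/-- The Christoffel symbols of a diagonal metric with components `h c` and first derivatives
`dh a c`. -/
def diagChristoffel (h : Fin D → ℝ) (dh : Fin D → Fin D → ℝ) (c a b : Fin D) : ℝ :=
  (2 * h c)⁻¹ * ((if b = c then dh a c else 0) + (if a = c then dh b c else 0)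
    - (if a = b then dh c a else 0))

theorem christoffel_diag {g : MetricField D} {h : Fin D → Chart D → ℝ}
    (hg : ∀ y a b, g y a b = if a = b then h a y else 0) {y : Chart D} (hy : ∀ a, h a y ≠ 0)
    (c a b : Fin D) :
    christoffel g y c a b =
      diagChristoffel (fun a => h a y) (fun a b => partialD a (h b) y) c a b := by
  have hdiag : Matrix.of (g y) = Matrix.diagonal (fun a => h a y) := by
    ext a b
    simp [hg, Matrix.diagonal_apply]
  have hinv : ∀ a b, invMetric g y a b = if a = b then (h a y)⁻¹ else 0 := by
    intro a b
    unfold invMetric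
    rw [hdiag, Matrix.inv_eq_right_inv (B := Matrix.diagonal fun a => (h a y)⁻¹)]
    · simp [Matrix.diagonal_apply]
    · rw [Matrix.diagonal_mul_diagonal]
      simp [hy]
  have hpart : ∀ a b e, partialD a (fun y => g y b e) y = if b = e then partialD a (h b) y else 0 :=
    fun a b e => by
      simp only [hg]
      exact partialD_ite _ _ _ _
  simp only [christoffel, hinv, hpart, ite_mul, zero_mul, Finset.sum_ite_eq, Finset.mem_univ,
    if_true, diagChristoffel]
  rw [mul_inv]
  by_cases h1 : b = c <;> by_cases h2 : a = c <;> simp [h1, h2] <;> ring_nf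

theorem partialD_christoffel_diag {g : MetricField D} {h : Fin D → Chart D → ℝ}
    (hg : ∀ y a b, g y a b = if a = b then h a y else 0) {x : Chart D} (hx : ∀ a, h a x ≠ 0)
    (hd : ∀ a, DifferentiableAt ℝ (h a) x)
    (hdd : ∀ a b, DifferentiableAt ℝ (partialD a (h b)) x) (k c a b : Fin D) :
    partialD k (fun y => christoffel g y c a b) x =
      -(partialD k (h c) x) / h c x *
        diagChristoffel (fun a => h a x) (fun a b => partialD a (h b) x) c a b +
      diagChristoffel (fun a => h a x) (fun a b => partialD k (partialD a (h b)) x) c a b := by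
  have hne : ∀ᶠ y in nhds x, ∀ a, h a y ≠ 0 :=
    Filter.eventually_all.2 fun a => (hd a).continuousAt.eventually_ne (hx a)
  have hite : ∀ (p : Prop) [Decidable p] (F : Chart D → ℝ), DifferentiableAt ℝ F x →
      DifferentiableAt ℝ (fun y => if p then F y else 0) x := by
    intro p _ F hF
    split_ifs
    · exact hF
    · exact differentiableAt_const _
  rw [partialD_congr (hne.mono fun y hy => christoffel_diag hg hy c a b)]
  simp only [diagChristoffel]
  have h2 : DifferentiableAt ℝ (fun y => 2 * h c y) x := (hd c).const_mul 2
  have h2ne : 2 * h c x ≠ 0 := mul_ne_zero two_ne_zero (hx c)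
  have e1 : DifferentiableAt ℝ (fun y => if b = c then partialD a (h c) y else 0) x :=
    hite _ _ (hdd a c)
  have e2 : DifferentiableAt ℝ (fun y => if a = c then partialD b (h c) y else 0) x :=
    hite _ _ (hdd b c)
  have e3 : DifferentiableAt ℝ (fun y => if a = b then partialD c (h a) y else 0) x :=
    hite _ _ (hdd c a)
  have e12 : DifferentiableAt ℝ (fun y => (if b = c then partialD a (h c) y else 0) +
    if a = c then partialD b (h c) y else 0) x := e1.add e2
  have e123 : DifferentiableAt ℝ (fun y => (if b = c then partialD a (h c) y else 0) +
    (if a = c then partialD b (h c) y else 0) - if a = b then partialD c (h a) y else 0) x :=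
    e12.sub e3
  have hi : DifferentiableAt ℝ (fun y => (2 * h c y)⁻¹) x := h2.inv h2ne
  rw [partialD_mul hi e123, partialD_sub e12 e3, partialD_add e1 e2,
    partialD_ite, partialD_ite, partialD_ite,
    partialD_comp (φ := fun t => t⁻¹) (differentiableAt_inv h2ne) h2,
    partialD_mul (differentiableAt_const _) (hd c), partialD_const, deriv_inv]
  have := hx c
  field_simp
  ring

theorem sum_diagChristoffel_mul {h : Fin D → ℝ} {o : Fin D} {H : Fin D → ℝ} (e c : Fin D)
    (F : Fin D → ℝ) :
    ∑ p, diagChristoffel h (fun a b => if a = o then H b else 0) e c p * F p =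
      (2 * h e)⁻¹ * ((if c = o then H e else 0) * F e + (if c = e then H e * F o else 0)
        - (if e = o then H c else 0) * F c) := by
  have : ∀ p, diagChristoffel h (fun a b => if a = o then H b else 0) e c p * F p =
      (2 * h e)⁻¹ * ((if p = e then (if c = o then H e else 0) * F p else 0)
        + (if p = o then (if c = e then H e * F p else 0) else 0)
        - (if c = p then (if e = o then H c else 0) * F p else 0)) := by
    intro p
    simp only [diagChristoffel]
    split_ifs <;> ring
  simp only [this, ← Finset.mul_sum, Finset.sum_add_distrib, Finset.sum_sub_distrib,
    Finset.sum_ite_eq, Finset.sum_ite_eq', Finset.mem_univ, if_true]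

/-- The components `R_{abab}` of the Riemann tensor at a point of a diagonal metric `h` whose
first derivatives are nonzero in the direction `o` only, where they are `H`. The second derivative
of `h b` is `H₂ b` in the direction `o` and `σ a b` in any other direction `a`. -/
def diagSectional (h H H₂ : Fin D → ℝ) (σ : Fin D → Fin D → ℝ) (o a b : Fin D) : ℝ :=
  if a = o then -H₂ b / 2 + H b ^ 2 / (4 * h b) + H b * H o / (4 * h o)
  else if b = o then -H₂ a / 2 + H a ^ 2 / (4 * h a) + H a * H o / (4 * h o)
  else -(H a * H b) / (4 * h o) - (σ a b + σ b a) / 2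

-- A finite check over the coincidences among `e, b, c, d` and the special direction `o`;
-- antisymmetry disposes of `c = d` beforehand.
set_option maxHeartbeats 2000000 in
theorem riemannUp_diag_algebra {h H H₂ : Fin D → ℝ} {σ : Fin D → Fin D → ℝ} {o : Fin D}
    (hh : ∀ a, h a ≠ 0) (hσ : ∀ a, σ a o = 0) (hσ' : ∀ a, σ o a = 0) (e b c d : Fin D) :
    (-(if c = o then H e else 0) / h e *
        diagChristoffel h (fun a b => if a = o then H b else 0) e d b +
      diagChristoffel h (fun a b => (if c = o then (if a = o then H₂ b else 0) else 0)
        + if c = a then σ a b else 0) e d b)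
    - (-(if d = o then H e else 0) / h e *
        diagChristoffel h (fun a b => if a = o then H b else 0) e c b +
      diagChristoffel h (fun a b => (if d = o then (if a = o then H₂ b else 0) else 0)
        + if d = a then σ a b else 0) e c b)
    + ((2 * h e)⁻¹ * ((if c = o then H e else 0) *
          diagChristoffel h (fun a b => if a = o then H b else 0) e d b
        + (if c = e then H e * diagChristoffel h (fun a b => if a = o then H b else 0) o d b else 0)
        - (if e = o then H c else 0) *
          diagChristoffel h (fun a b => if a = o then H b else 0) c d b)
      - (2 * h e)⁻¹ * ((if d = o then H e else 0) *
          diagChristoffel h (fun a b => if a = o then H b else 0) e c b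
        + (if d = e then H e * diagChristoffel h (fun a b => if a = o then H b else 0) o c b else 0)
        - (if e = o then H d else 0) *
          diagChristoffel h (fun a b => if a = o then H b else 0) d c b))
    = (h e)⁻¹ * (diagSectional h H H₂ σ o e b * ((if e = c then 1 else 0) * (if b = d then 1 else 0)
    - (if e = d then 1 else 0) * (if b = c then 1 else 0))) := by
  have h1 := hh e
  have h2 := hh o
  have h3 := hh b
  have h4 := hh c
  have h5 := hh d
  simp only [diagChristoffel, diagSectional]
  rcases eq_or_ne c d with rfl | hcd
  · ring
  simp only [if_true, @eq_comm _ b e, @eq_comm _ c e, @eq_comm _ d e, @eq_comm _ c b,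
    @eq_comm _ d b, @eq_comm _ d c, if_neg hcd]
  by_cases heo : e = o <;> by_cases hbo : b = o <;>
  by_cases hec : e = c <;> by_cases hed : e = d <;> by_cases hbc : b = c <;> by_cases hbd : b = d <;>
  by_cases hco : c = o <;> by_cases hdo : d = o <;>
  first
  | (exfalso; subst_vars; simp at * <;> done)
  | (simp only [if_pos, if_neg, heo, hbo, hec, hed, hbc, hbd, hco, hdo, not_false_eq_true]
     subst_vars
     try simp only [hσ, hσ']
     (try split_ifs) <;> first
     | done
     | (exfalso; subst_vars; simp_all; done)
     | (field_simp; done)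
     | (field_simp; ring1))

/-- The hypotheses describe the ansatz at the origin of the stereographic chart, where the conformal
factor has zero gradient: only radial first derivatives survive, and `σ` is its Hessian. -/
theorem riemann_diag {g : MetricField D} {h : Fin D → Chart D → ℝ}
    (hg : ∀ y a b, g y a b = if a = b then h a y else 0) {x : Chart D} (hx : ∀ a, h a x ≠ 0)
    (hd : ∀ a, DifferentiableAt ℝ (h a) x)
    (hdd : ∀ a b, DifferentiableAt ℝ (partialD a (h b)) x) {o : Fin D} {H H₂ : Fin D → ℝ}
    {σ : Fin D → Fin D → ℝ} (hσ : ∀ a, σ a o = 0) (hσ' : ∀ a, σ o a = 0)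
    (hH : ∀ a b, partialD a (h b) x = if a = o then H b else 0)
    (hH₂ : ∀ k a b, partialD k (partialD a (h b)) x =
      (if k = o then (if a = o then H₂ b else 0) else 0) + if k = a then σ a b else 0)
    (a b c d : Fin D) :
    riemann g x a b c d = diagSectional (fun a => h a x) H H₂ σ o a b *
      ((if a = c then 1 else 0) * (if b = d then 1 else 0)
        - (if a = d then 1 else 0) * (if b = c then 1 else 0)) := by
  have key : ∀ e, riemannUp g x e b c d = _ := fun e => by
    simp only [riemannUp, partialD_christoffel_diag hg hx hd hdd, christoffel_diag hg hx, hH, hH₂,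
      Finset.sum_sub_distrib, sum_diagChristoffel_mul]
    exact riemannUp_diag_algebra (h := fun a => h a x) hx hσ hσ' e b c d
  simp only [riemann, hg, key, ite_mul, zero_mul, Finset.sum_ite_eq, Finset.mem_univ, if_true]
  rw [mul_inv_cancel_left₀ (hx a)]

/-! ### The curvature of static and spherically symmetric metrics -/

section SSS

variable {d : ℕ}

/-- The squared norm of the stereographic coordinates. -/
def stereoNormSq (x : Chart (d + 2)) : ℝ := ∑ j : Fin d, x j.succ.succ ^ 2

/-- The part of a covector along the sphere. -/
def stereoPart (a : Fin (d + 2)) (x : Chart (d + 2)) : ℝ := if 2 ≤ a.val then x a else 0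

/-- The diagonal components of `sssMetric d 1 f`. -/
def sssDiag (f : ℝ → ℝ) (a : Fin (d + 2)) (x : Chart (d + 2)) : ℝ :=
  if 2 ≤ a.val then x 1 ^ 2 * (4 / (1 + stereoNormSq x) ^ 2)
    else if a = 1 then (f (x 1))⁻¹ else -f (x 1)

theorem sssMetric_eq (f : ℝ → ℝ) (y : Chart (d + 2)) (a b : Fin (d + 2)) :
    sssMetric d (fun _ => 1) f y a b = if a = b then sssDiag f a y else 0 := by
  unfold sssMetric
  congr 1
  refine Fin.cases ?_ (fun a => ?_) a
  · simp [sssDiag]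
  refine Fin.cases ?_ (fun a => ?_) a
  · simp [sssDiag]
  · simp [sssDiag, stereoNormSq]

theorem differentiable_stereoNormSq : Differentiable ℝ (stereoNormSq (d := d)) := by
  unfold stereoNormSq
  fun_prop

theorem differentiable_stereoPart (a : Fin (d + 2)) : Differentiable ℝ (stereoPart a) := by
  unfold stereoPart
  split_ifs <;> fun_prop

theorem partialD_stereoNormSq (a : Fin (d + 2)) (x : Chart (d + 2)) :
    partialD a stereoNormSq x = 2 * stereoPart a x := by
  have h : HasFDerivAt (stereoNormSq (d := d)) (∑ j : Fin d, (2 * x j.succ.succ) •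
      ContinuousLinearMap.proj (R := ℝ) (φ := fun _ : Fin (d + 2) => ℝ) j.succ.succ) x := by
    refine HasFDerivAt.fun_sum fun j _ => ?_
    have := (hasFDerivAt_apply (𝕜 := ℝ) (F' := fun _ : Fin (d + 2) => ℝ) j.succ.succ x).pow 2
    simpa using this
  rw [partialD, h.fderiv]
  simp only [sum_apply, smul_apply,
    ContinuousLinearMap.proj_apply, Pi.single_apply, smul_eq_mul, mul_ite, mul_one, mul_zero]
  refine Fin.cases ?_ (fun a => ?_) a
  · simp [stereoPart, Fin.ext_iff]
  refine Fin.cases ?_ (fun a => ?_) a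
  · simp [stereoPart, Fin.ext_iff]
  · simp [stereoPart]

theorem stereoNormSq_nonneg (x : Chart (d + 2)) : 0 ≤ stereoNormSq x :=
  Finset.sum_nonneg fun _ _ => sq_nonneg _

theorem partialD_conformal (n : ℕ) (a : Fin (d + 2)) (x : Chart (d + 2)) :
    partialD a (fun y => ((1 + stereoNormSq y) ^ n)⁻¹) x =
      -2 * n * ((1 + stereoNormSq x) ^ (n + 1))⁻¹ * stereoPart a x := by
  have hpos : 0 < 1 + stereoNormSq x := by linarith [stereoNormSq_nonneg x]
  have hne := hpos.ne'
  have hφ : HasDerivAt (fun t : ℝ => ((1 + t) ^ n)⁻¹)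
      (-(n * (1 + stereoNormSq x) ^ (n - 1)) / ((1 + stereoNormSq x) ^ n) ^ 2)
      (stereoNormSq x) := by
    have := (((hasDerivAt_id (stereoNormSq x)).const_add 1).pow n).inv (pow_ne_zero n hne)
    refine HasDerivAt.congr_deriv this ?_
    simp
  rw [partialD_comp (φ := fun t => ((1 + t) ^ n)⁻¹) hφ.differentiableAt
    (differentiable_stereoNormSq x), hφ.deriv, partialD_stereoNormSq]
  -- The derivative of the power contains the truncated exponent `n - 1`, hence the separate case `n
  -- = 0`.
  rcases n with _ | n
  · simp
  · rw [Nat.add_sub_cancel]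
    field_simp
    ring

theorem partialD_radial {a : Fin (d + 2)} {φ : ℝ → ℝ} {x : Chart (d + 2)}
    (hφ : DifferentiableAt ℝ φ (x 1)) :
    partialD a (fun y => φ (y 1)) x = if a = 1 then deriv φ (x 1) else 0 := by
  rw [partialD_comp hφ (by fun_prop), partialD_apply]
  simp

theorem differentiableAt_conformal (n : ℕ) (x : Chart (d + 2)) :
    DifferentiableAt ℝ (fun y : Chart (d + 2) => ((1 + stereoNormSq y) ^ n)⁻¹) x := by
  have hpos : 0 < 1 + stereoNormSq x := by linarith [stereoNormSq_nonneg x]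
  exact (((differentiable_stereoNormSq x).const_add 1).pow n).inv (pow_ne_zero n hpos.ne')

/-- The first partial derivatives of `sssDiag f b`. -/
theorem partialD_sssDiag {f : ℝ → ℝ} {x : Chart (d + 2)} (hf : DifferentiableAt ℝ f (x 1))
    (hf0 : f (x 1) ≠ 0) (a b : Fin (d + 2)) :
    partialD a (sssDiag f b) x = if 2 ≤ b.val then
      (if a = 1 then 8 * x 1 * ((1 + stereoNormSq x) ^ 2)⁻¹ else 0)
        + x 1 ^ 2 * (-16 * ((1 + stereoNormSq x) ^ 3)⁻¹ * stereoPart a x)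
      else if b = 1 then (if a = 1 then -deriv f (x 1) / f (x 1) ^ 2 else 0)
        else (if a = 1 then -deriv f (x 1) else 0) := by
  unfold sssDiag
  by_cases hb : 2 ≤ b.val
  · have h8 : deriv (fun t : ℝ => t ^ 2) (x 1) = 2 * x 1 := by simp
    simp only [if_pos hb, div_eq_mul_inv]
    rw [partialD_mul (by fun_prop) ((differentiableAt_conformal 2 x).const_mul 4),
      partialD_mul (differentiableAt_const _) (differentiableAt_conformal 2 x), partialD_const,
      partialD_conformal, partialD_radial (φ := fun t => t ^ 2) (by fun_prop), h8]
    split_ifs <;> push_cast <;> ring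
  by_cases hb1 : b = 1
  · simp only [if_neg hb, if_pos hb1]
    rw [partialD_radial (φ := fun t => (f t)⁻¹) (hf.inv hf0), deriv_fun_inv'' hf hf0]
  · simp only [if_neg hb, if_neg hb1]
    rw [partialD_radial (φ := fun t => -f t) hf.neg, deriv.fun_neg]

/-- The point of the radius `r` at which invariants are evaluated. -/
def sssPoint (d : ℕ) (r : ℝ) : Chart (d + 2) :=
  Matrix.vecCons 0 (Matrix.vecCons r (fun _ : Fin d => 0))

theorem sssPoint_one (r : ℝ) : sssPoint d r 1 = r := rfl

theorem stereoNormSq_sssPoint (r : ℝ) : stereoNormSq (sssPoint d r) = 0 := by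
  simp [stereoNormSq, sssPoint]

theorem stereoPart_sssPoint (a : Fin (d + 2)) (r : ℝ) : stereoPart a (sssPoint d r) = 0 := by
  refine Fin.cases ?_ (fun a => ?_) a
  · simp [stereoPart]
  refine Fin.cases ?_ (fun a => ?_) a
  · simp [stereoPart]
  · simp [stereoPart, sssPoint]

theorem partialD_stereoPart (k a : Fin (d + 2)) (x : Chart (d + 2)) :
    partialD k (stereoPart a) x = if k = a then (if 2 ≤ a.val then 1 else 0) else 0 := by
  unfold stereoPart
  rw [partialD_ite, partialD_apply]
  split_ifs <;> rfl

/-- At `y = 0` the Hessian of `4 r² / (1 + |y|²)²` is `8` in the radial direction and `-16 r²` along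
the sphere, without cross terms. -/
theorem partialD_partialD_sssDiag {f : ℝ → ℝ} {r : ℝ} (hf : ContDiffAt ℝ ∞ f r)
    (hf0 : f r ≠ 0) (a b : Fin (d + 2)) :
    DifferentiableAt ℝ (partialD a (sssDiag f b)) (sssPoint d r) ∧
    ∀ k, partialD k (partialD a (sssDiag f b)) (sssPoint d r) =
      (if k = 1 then (if a = 1 then (if 2 ≤ b.val then 8 else if b = 1 then
        deriv (fun t => -deriv f t / f t ^ 2) r else -deriv (deriv f) r) else 0) else 0)
      + if k = a then (if 2 ≤ a.val then (if 2 ≤ b.val then -16 * r ^ 2 else 0) else 0) else 0 := by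
  have hf' : DifferentiableAt ℝ (deriv f) r :=
    (hf.derivWithin (m := 1) (by norm_cast)).differentiableAt one_ne_zero
  have hfd : DifferentiableAt ℝ f r := hf.differentiableAt (by norm_cast)
  have hcont : Filter.Tendsto (fun x : Chart (d + 2) => x 1) (nhds (sssPoint d r)) (nhds r) :=
    (continuous_apply (1 : Fin (d + 2))).tendsto (sssPoint d r)
  have hev : ∀ᶠ t in nhds r, DifferentiableAt ℝ f t ∧ f t ≠ 0 := by
    refine ((hf.of_le (m := 1) (by norm_cast)).eventually (by simp)).mono ?_ |>.and
      (hf.continuousAt.eventually_ne hf0)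
    exact fun t ht => ht.differentiableAt one_ne_zero
  -- Differentiating once more requires the first derivatives near the point, not only at it.
  have heq := (hcont.eventually hev).mono fun x hx => partialD_sssDiag hx.1 hx.2 a b
  have hq : DifferentiableAt ℝ (fun t => -deriv f t / f t ^ 2) r :=
    hf'.neg.div (hfd.pow 2) (pow_ne_zero 2 hf0)
  have hx1 : DifferentiableAt ℝ (fun x : Chart (d + 2) => x 1) (sssPoint d r) := by fun_prop
  have hite : ∀ {F : Chart (d + 2) → ℝ}, DifferentiableAt ℝ F (sssPoint d r) →
      DifferentiableAt ℝ (fun x => if a = 1 then F x else 0) (sssPoint d r) := by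
    intro F hF
    split_ifs
    · exact hF
    · exact differentiableAt_const _
  suffices h : DifferentiableAt ℝ (fun x : Chart (d + 2) => if 2 ≤ b.val then
      (if a = 1 then 8 * x 1 * ((1 + stereoNormSq x) ^ 2)⁻¹ else 0)
        + x 1 ^ 2 * (-16 * ((1 + stereoNormSq x) ^ 3)⁻¹ * stereoPart a x)
      else if b = 1 then (if a = 1 then -deriv f (x 1) / f (x 1) ^ 2 else 0)
        else (if a = 1 then -deriv f (x 1) else 0)) (sssPoint d r) ∧ ∀ k,
      partialD k (fun x : Chart (d + 2) => if 2 ≤ b.val then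
      (if a = 1 then 8 * x 1 * ((1 + stereoNormSq x) ^ 2)⁻¹ else 0)
        + x 1 ^ 2 * (-16 * ((1 + stereoNormSq x) ^ 3)⁻¹ * stereoPart a x)
      else if b = 1 then (if a = 1 then -deriv f (x 1) / f (x 1) ^ 2 else 0)
        else (if a = 1 then -deriv f (x 1) else 0)) (sssPoint d r) = _ from
    ⟨h.1.congr_of_eventuallyEq heq, fun k => (partialD_congr heq).trans (h.2 k)⟩
  by_cases hb : 2 ≤ b.val
  · simp only [if_pos hb]
    have d1 : DifferentiableAt ℝ (fun x : Chart (d + 2) => 8 * x 1) (sssPoint d r) :=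
      hx1.const_mul 8
    have d2 := differentiableAt_conformal 2 (sssPoint d r)
    have d3 := (differentiableAt_conformal 3 (sssPoint d r)).const_mul (-16)
    have d4 := differentiable_stereoPart a (sssPoint d r)
    have d5 : DifferentiableAt ℝ (fun x : Chart (d + 2) => x 1 ^ 2) (sssPoint d r) := by fun_prop
    have d12 : DifferentiableAt ℝ (fun x : Chart (d + 2) =>
        if a = 1 then 8 * x 1 * ((1 + stereoNormSq x) ^ 2)⁻¹ else 0) (sssPoint d r) :=
      hite (d1.mul d2)
    have d34 : DifferentiableAt ℝ (fun x : Chart (d + 2) =>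
        -16 * ((1 + stereoNormSq x) ^ 3)⁻¹ * stereoPart a x) (sssPoint d r) := d3.mul d4
    have d534 : DifferentiableAt ℝ (fun x : Chart (d + 2) =>
        x 1 ^ 2 * (-16 * ((1 + stereoNormSq x) ^ 3)⁻¹ * stereoPart a x)) (sssPoint d r) :=
      d5.mul d34
    refine ⟨d12.add d534, fun k => ?_⟩
    rw [partialD_add d12 d534, partialD_ite, partialD_mul d1 d2,
      partialD_mul (differentiableAt_const _) hx1, partialD_const, partialD_apply,
      partialD_conformal, partialD_mul d5 d34, partialD_mul d3 d4, partialD_stereoPart]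
    simp only [stereoPart_sssPoint, stereoNormSq_sssPoint, sssPoint_one]
    split_ifs <;> simp
    all_goals ring
  · simp only [if_neg hb]
    by_cases hb1 : b = 1
    · simp only [if_pos hb1]
      have d1 : DifferentiableAt ℝ (fun x : Chart (d + 2) => -deriv f (x 1) / f (x 1) ^ 2)
        (sssPoint d r) :=
        DifferentiableAt.comp (g := fun t => -deriv f t / f t ^ 2) (sssPoint d r) hq hx1
      refine ⟨hite d1, fun k => ?_⟩
      rw [partialD_ite, partialD_radial (φ := fun t => -deriv f t / f t ^ 2) hq, sssPoint_one]
      split_ifs <;> simp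
    · simp only [if_neg hb1]
      have d1 : DifferentiableAt ℝ (fun x : Chart (d + 2) => -deriv f (x 1))
        (sssPoint d r) :=
        DifferentiableAt.comp (g := fun t => -deriv f t) (sssPoint d r) hf'.neg hx1
      refine ⟨hite d1, fun k => ?_⟩
      rw [partialD_ite, partialD_radial (φ := fun t => -deriv f t) hf'.neg, sssPoint_one]
      split_ifs <;> simp

/-- The curvature of the static and spherically symmetric metric with `N = 1`. -/
theorem riemann_sssMetric {f : ℝ → ℝ} {r : ℝ} (hf : ContDiffAt ℝ ∞ f r) (hf0 : f r ≠ 0)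
    (hr : r ≠ 0) (a b c e : Fin (d + 2)) :
    riemann (sssMetric d (fun _ => 1) f) (sssPoint d r) a b c e =
      sssDiag f a (sssPoint d r) * sssDiag f b (sssPoint d r) * CurvTensor.diagCurv
        (sssCurv (-deriv (deriv f) r / 2) (-deriv f r / (2 * r)) ((1 - f r) / r ^ 2)) a b c e := by
  have hfd : DifferentiableAt ℝ f r := hf.differentiableAt (by norm_cast)
  have hval : ∀ a : Fin (d + 2), sssDiag f a (sssPoint d r) =
      if 2 ≤ a.val then 4 * r ^ 2 else if a = 1 then (f r)⁻¹ else -f r := by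
    intro a
    simp only [sssDiag, stereoNormSq_sssPoint, sssPoint_one]
    split_ifs <;> ring
  have hne : ∀ a : Fin (d + 2), sssDiag f a (sssPoint d r) ≠ 0 := by
    intro a
    rw [hval]
    split_ifs
    · positivity
    · exact inv_ne_zero hf0
    · exact neg_ne_zero.2 hf0
  have hd : ∀ b : Fin (d + 2), DifferentiableAt ℝ (sssDiag f b) (sssPoint d r) := by
    intro b
    have hx1 : DifferentiableAt ℝ (fun x : Chart (d + 2) => x 1) (sssPoint d r) := by fun_prop
    have h1 : DifferentiableAt ℝ (fun x : Chart (d + 2) => f (x 1)) (sssPoint d r) :=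
      DifferentiableAt.comp (sssPoint d r) hfd hx1
    unfold sssDiag
    split_ifs
    · simp only [div_eq_mul_inv]
      exact (hx1.pow 2).mul ((differentiableAt_conformal 2 _).const_mul 4)
    · exact h1.inv hf0
    · exact h1.neg
  rw [riemann_diag (sssMetric_eq f) hne hd
    (fun a b => (partialD_partialD_sssDiag hf hf0 a b).1) (o := 1)
    (H := fun b => if 2 ≤ b.val then 8 * r else if b = 1 then -deriv f r / f r ^ 2 else -deriv f r)
    (H₂ := fun b => if 2 ≤ b.val then 8 else if b = 1 then
        deriv (fun t => -deriv f t / f t ^ 2) r else -deriv (deriv f) r)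
    (σ := fun a b => if 2 ≤ a.val then (if 2 ≤ b.val then -16 * r ^ 2 else 0) else 0)
    (fun a => by simp) (fun a => by simp) ?_
    (fun k a b => (partialD_partialD_sssDiag hf hf0 a b).2 k)]
  · by_cases hab : a = b
    · subst hab
      simp only [CurvTensor.diagCurv]
      ring
    simp only [CurvTensor.diagCurv, ← mul_assoc]
    congr 1
    have hlt : ∀ a : Fin (d + 2), a.val ≤ 1 ↔ ¬ 2 ≤ a.val := fun a => by omega
    have h11 : ¬ 2 ≤ (1 : Fin (d + 2)).val := by simp
    have h00 : ∀ a : Fin (d + 2), ¬ 2 ≤ a.val → a ≠ 1 → a = 0 := fun a h h' => by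
      rw [Ne, Fin.ext_iff, Fin.val_one] at h'
      rw [Fin.ext_iff, Fin.val_zero]
      omega
    simp only [diagSectional, hval, sssCurv, if_neg hab, hlt, if_neg h11, if_true]
    by_cases ha1 : a = 1 <;> by_cases hb1 : b = 1 <;> by_cases ha : 2 ≤ a.val <;>
      by_cases hb : 2 ≤ b.val
    all_goals first
    | exact absurd (ha1.trans hb1.symm) hab
    | (rw [ha1] at ha; exact absurd ha h11)
    | (rw [hb1] at hb; exact absurd hb h11)
    | exact absurd ((h00 a ha ha1).trans (h00 b hb hb1).symm) hab
    | (simp only [ha1, hb1, ha, hb, if_true, if_false, h11, not_true, not_false_eq_true]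
       field_simp
       ring)
  · intro a b
    rw [partialD_sssDiag (by rwa [sssPoint_one]) (by rwa [sssPoint_one])]
    simp only [stereoPart_sssPoint, stereoNormSq_sssPoint, sssPoint_one]
    split_ifs <;> simp

end SSS

/-- This reduces evaluation on the metric to a function of the three sectional values. Complex
square roots are unavoidable: `-f` and `1/f` have opposite signs. -/
theorem sssValue_eq_frameEval {d : ℕ} {M : CurvInvariant} (hM : M.NablaFree) {f : ℝ → ℝ} {r : ℝ}
    (hf : ContDiffAt ℝ ∞ f r) (hf0 : f r ≠ 0) (hr : r ≠ 0) :
    sssValue d M (fun _ => 1) f r = CurvTensor.frameEval (CurvTensor.diagCurv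
      (sssCurv (d := d) (-deriv (deriv f) r / 2) (-deriv f r / (2 * r)) ((1 - f r) / r ^ 2)))
      M ![] := by
  choose s hs using fun a : Fin (d + 2) =>
    IsAlgClosed.exists_eq_mul_self ((sssDiag f a (sssPoint d r) : ℝ) : ℂ)
  have hne : ∀ a : Fin (d + 2), sssDiag f a (sssPoint d r) ≠ 0 := by
    intro a
    simp only [sssDiag, stereoNormSq_sssPoint, sssPoint_one]
    split_ifs
    · simp [hr]
    · exact inv_ne_zero hf0
    · exact neg_ne_zero.2 hf0
  have h := CurvTensor.eval_eq_frameEval M hM (sssMetric d (fun _ => 1) f) (sssPoint d r) s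
    (fun a h0 => hne a (by
      have := hs a
      rw [h0, mul_zero] at this
      exact_mod_cast this))
    (fun a b => by
      rw [sssMetric_eq]
      split_ifs
      · exact hs a
      · simp)
    (CurvTensor.diagCurv
      (sssCurv (d := d) (-deriv (deriv f) r / 2) (-deriv f r / (2 * r)) ((1 - f r) / r ^ 2)))
    (fun a b c e => by
      rw [riemann_sssMetric hf hf0 hr]
      push_cast
      rw [hs a, hs b]
      simp only [CurvTensor.diagCurv]
      by_cases h1 : a = c <;> by_cases h2 : b = e <;> by_cases h3 : a = e <;> by_cases h4 : b = c
      all_goals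
        simp only [h1, h2, h3, h4, if_true, if_false]
        push_cast
        ring)
    ![]
  rw [Fin.prod_univ_zero, one_mul] at h
  exact_mod_cast h

theorem isReducible_of_vanishing {D : ℕ} {L : CurvInvariant}
    (h : ∀ (g : MetricField D) (x : Chart D), (∀ a b, ricci g x a b = 0) → L.value g x = 0) :
    IsReducible D L := by
  refine ⟨0, fun _ _ => 0, contDiffOn_const, fun U g hg x hx => ?_⟩
  rw [h g x (hg.ricci_eq_zero x hx)]
  simp [partialD_const]

/-! ### Total derivatives have vanishing Euler-Lagrange expressions -/

theorem contDiffOn_totalDerivative {T : ℝ × ℝ × ℝ → ℝ}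
    (hT : ContDiffOn ℝ ∞ T {q | 0 < q.1}) :
    ContDiffOn ℝ ∞ (fun p : ℝ × (Fin 3 → ℝ) =>
      fderiv ℝ T (p.1, p.2 0, p.2 1) (1, p.2 1, p.2 2)) {p | 0 < p.1 ∧ p.2 0 ≠ 0} := by
  have hopen : IsOpen {q : ℝ × ℝ × ℝ | 0 < q.1} := isOpen_lt continuous_const continuous_fst
  have h1 : ContDiffOn ℝ ∞ (fderiv ℝ T) {q | 0 < q.1} := hT.fderiv_of_isOpen hopen (by simp)
  have h2 : ContDiff ℝ ∞ (fun p : ℝ × (Fin 3 → ℝ) => (p.1, p.2 0, p.2 1)) := by fun_prop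
  have h3 : ContDiff ℝ ∞ (fun p : ℝ × (Fin 3 → ℝ) => ((1 : ℝ), p.2 1, p.2 2)) := by fun_prop
  exact (h1.comp h2.contDiffOn fun p hp => hp.1).clm_apply h3.contDiffOn

theorem radialJet_two (f : ℝ → ℝ) (s : ℝ) :
    radialJet 2 f s 0 = f s ∧ radialJet 2 f s 1 = deriv f s ∧
      radialJet 2 f s 2 = deriv (deriv f) s := by
  refine ⟨rfl, ?_, ?_⟩
  · simp [radialJet, iteratedDeriv_one]
  · change iteratedDeriv 2 f s = _
    rw [iteratedDeriv_succ, iteratedDeriv_one]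

theorem fderiv_totalDerivative {T : ℝ × ℝ × ℝ → ℝ} {s : ℝ} {p : Fin 3 → ℝ}
    (hT : DifferentiableAt ℝ (fderiv ℝ T) (s, p 0, p 1)) (v : Fin 3 → ℝ) :
    fderiv ℝ (fun p : Fin 3 → ℝ => fderiv ℝ T (s, p 0, p 1) (1, p 1, p 2)) p v =
      fderiv ℝ (fderiv ℝ T) (s, p 0, p 1) (0, v 0, v 1) (1, p 1, p 2)
        + fderiv ℝ T (s, p 0, p 1) (0, v 1, v 2) := by
  have hproj : ∀ i : Fin 3, HasFDerivAt (fun p : Fin 3 → ℝ => p i)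
      (ContinuousLinearMap.proj (R := ℝ) (φ := fun _ : Fin 3 => ℝ) i) p := fun i =>
    hasFDerivAt_apply i p
  have h1 : HasFDerivAt (fun p : Fin 3 → ℝ => (s, p 0, p 1)) _ p :=
    (hasFDerivAt_const s p).prodMk ((hproj 0).prodMk (hproj 1))
  have h2 : HasFDerivAt (fun p : Fin 3 → ℝ => ((1 : ℝ), p 1, p 2)) _ p :=
    (hasFDerivAt_const (1 : ℝ) p).prodMk ((hproj 1).prodMk (hproj 2))
  have h3 : HasFDerivAt (fun p : Fin 3 → ℝ => fderiv ℝ T (s, p 0, p 1)) _ p :=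
    HasFDerivAt.comp (g := fderiv ℝ T) p hT.hasFDerivAt h1
  rw [(h3.clm_apply h2).fderiv]
  simp [add_comm]

/-- For `ℓ = dT/dr` with `T(r, f, f')`, the derivatives of `ℓ` by `f, f', f''` are `d(T_f)/dr`,
`d(T_f')/dr + T_f` and `T_f'`; their alternating sum telescopes. Below, `u` is `T_f'` and `v` is
`T_f`. -/
theorem eulerLagrange_totalDerivative {T : ℝ × ℝ × ℝ → ℝ}
    (hT : ContDiffOn ℝ ∞ T {q | 0 < q.1}) {I : Set ℝ} {f : ℝ → ℝ} (hf : IsRadialProfile I f)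
    {r : ℝ} (hr : r ∈ I) :
    eulerLagrange 2 (fun s p => fderiv ℝ T (s, p 0, p 1) (1, p 1, p 2)) f r = 0 := by
  have hopen : IsOpen {q : ℝ × ℝ × ℝ | 0 < q.1} := isOpen_lt continuous_const continuous_fst
  have hD : ContDiffOn ℝ ∞ (fderiv ℝ T) {q | 0 < q.1} := hT.fderiv_of_isOpen hopen (by simp)
  have hDat : ∀ q : ℝ × ℝ × ℝ, 0 < q.1 →
      HasFDerivAt (fderiv ℝ T) (fderiv ℝ (fderiv ℝ T) q) q := fun q hq =>
    ((hD.contDiffAt (hopen.mem_nhds hq)).differentiableAt (by simp)).hasFDerivAt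
  have hsymm : ∀ q : ℝ × ℝ × ℝ, 0 < q.1 → IsSymmSndFDerivAt ℝ T q := fun q hq =>
    (hT.contDiffAt (hopen.mem_nhds hq)).isSymmSndFDerivAt (by simp; norm_cast)
  have hf1 : ContDiffOn ℝ ∞ (deriv f) I := hf.smooth.deriv_of_isOpen hf.isOpen (by simp)
  have hderiv : ∀ s ∈ I, HasDerivAt f (deriv f s) s := fun s hs =>
    ((hf.smooth.contDiffAt (hf.isOpen.mem_nhds hs)).differentiableAt (by simp)).hasDerivAt
  have hderiv2 : ∀ s ∈ I, HasDerivAt (deriv f) (deriv (deriv f) s) s := fun s hs =>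
    ((hf1.contDiffAt (hf.isOpen.mem_nhds hs)).differentiableAt (by simp)).hasDerivAt
  have hq : ∀ s ∈ I, HasDerivAt (fun s => (s, f s, deriv f s))
      (1, deriv f s, deriv (deriv f) s) s := fun s hs =>
    (hasDerivAt_id s).prodMk ((hderiv s hs).prodMk (hderiv2 s hs))
  have hcurve : ∀ v : ℝ × ℝ × ℝ, ∀ s ∈ I, HasDerivAt (fun s => fderiv ℝ T (s, f s, deriv f s) v)
      (fderiv ℝ (fderiv ℝ T) (s, f s, deriv f s) v (1, deriv f s, deriv (deriv f) s)) s := by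
    intro v s hs
    have h1 : HasDerivAt (fun s => fderiv ℝ T (s, f s, deriv f s))
        (fderiv ℝ (fderiv ℝ T) (s, f s, deriv f s) (1, deriv f s, deriv (deriv f) s)) s :=
      (hDat (s, f s, deriv f s) (hf.pos s hs)).comp_hasDerivAt s (hq s hs)
    have h2 : HasDerivAt (fun s => fderiv ℝ T (s, f s, deriv f s) v)
        (fderiv ℝ (fderiv ℝ T) (s, f s, deriv f s) (1, deriv f s, deriv (deriv f) s) v
          + fderiv ℝ T (s, f s, deriv f s) 0) s := h1.clm_apply (hasDerivAt_const s v)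
    rw [ContinuousLinearMap.map_zero, add_zero] at h2
    -- Symmetry of the second derivative exchanges `d/dr` with the partial derivative along `v`.
    rw [(hsymm (s, f s, deriv f s) (hf.pos s hs)).eq v]
    exact h2
  have hfib : ∀ s ∈ I, ∀ v : Fin 3 → ℝ,
      fderiv ℝ (fun p : Fin 3 → ℝ => fderiv ℝ T (s, p 0, p 1) (1, p 1, p 2)) (radialJet 2 f s) v =
      fderiv ℝ (fderiv ℝ T) (s, f s, deriv f s) (0, v 0, v 1) (1, deriv f s, deriv (deriv f) s)
        + fderiv ℝ T (s, f s, deriv f s) (0, v 1, v 2) := by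
    intro s hs v
    obtain ⟨h0, h1, h2⟩ := radialJet_two f s
    rw [fderiv_totalDerivative ((hDat (s, radialJet 2 f s 0, radialJet 2 f s 1)
      (hf.pos s hs)).differentiableAt) v, h0, h1, h2]
  set u : ℝ → ℝ := fun s => fderiv ℝ T (s, f s, deriv f s) (0, 0, 1) with hu
  set v : ℝ → ℝ := fun s => fderiv ℝ T (s, f s, deriv f s) (0, 1, 0) with hv
  have hu' : ∀ s ∈ I, deriv u s = fderiv ℝ (fderiv ℝ T) (s, f s, deriv f s) (0, 0, 1)
      (1, deriv f s, deriv (deriv f) s) := fun s hs => (hcurve _ s hs).deriv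
  have hv' : ∀ s ∈ I, deriv v s = fderiv ℝ (fderiv ℝ T) (s, f s, deriv f s) (0, 1, 0)
      (1, deriv f s, deriv (deriv f) s) := fun s hs => (hcurve _ s hs).deriv
  have husmooth : ContDiffOn ℝ ∞ u I := by
    have hq' : ContDiffOn ℝ ∞ (fun s => (s, f s, deriv f s)) I :=
      contDiffOn_id.prodMk (hf.smooth.prodMk hf1)
    exact (hD.comp hq' fun s hs => hf.pos s hs).clm_apply contDiffOn_const
  have hdu : DifferentiableAt ℝ (deriv u) r :=
    ((husmooth.deriv_of_isOpen (m := ∞) hf.isOpen (by simp)).contDiffAt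
      (hf.isOpen.mem_nhds hr)).differentiableAt (by simp)
  have hdv : DifferentiableAt ℝ v r := (hcurve _ r hr).differentiableAt
  have hI : ∀ᶠ s in nhds r, s ∈ I := hf.isOpen.mem_nhds hr
  have hz : ((0 : ℝ), (0 : ℝ), (0 : ℝ)) = 0 := rfl
  unfold eulerLagrange
  rw [Fin.sum_univ_three]
  have e0 : fderiv ℝ (fun p : Fin 3 → ℝ => fderiv ℝ T (r, p 0, p 1) (1, p 1, p 2))
      (radialJet 2 f r) (Pi.single 0 1) = deriv v r := by
    rw [hfib r hr, hv' r hr]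
    simp [hz]
  have e1 : (fun s => fderiv ℝ (fun p : Fin 3 → ℝ => fderiv ℝ T (s, p 0, p 1) (1, p 1, p 2))
      (radialJet 2 f s) (Pi.single 1 1)) =ᶠ[nhds r] fun s => deriv u s + v s := by
    refine hI.mono fun s hs => ?_
    simp only
    rw [hfib s hs, hu' s hs]
    simp [hv]
  have e2 : (fun s => fderiv ℝ (fun p : Fin 3 → ℝ => fderiv ℝ T (s, p 0, p 1) (1, p 1, p 2))
      (radialJet 2 f s) (Pi.single 2 1)) =ᶠ[nhds r] u := by
    refine hI.mono fun s hs => ?_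
    simp only
    rw [hfib s hs]
    simp [hu, hz]
  change (-1 : ℝ) ^ 0 * iteratedDeriv 0 _ r + (-1) ^ 1 * iteratedDeriv 1 _ r
    + (-1) ^ 2 * iteratedDeriv 2 _ r = 0
  rw [iteratedDeriv_zero, iteratedDeriv_one, iteratedDeriv_succ, iteratedDeriv_one, e0,
    e1.deriv_eq, e2.deriv.deriv_eq, deriv_fun_add hdu hdv]
  ring

theorem isGQTG_of_totalDerivative {d : ℕ} {Q : CurvInvariant} {T : ℝ × ℝ × ℝ → ℝ}
    (hT : ContDiffOn ℝ ∞ T {q | 0 < q.1})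
    (hQ : ∀ (f : ℝ → ℝ) (r : ℝ), ContDiffAt ℝ ∞ f r → f r ≠ 0 → 0 < r →
      r ^ d * sssValue d Q (fun _ => 1) f r =
        fderiv ℝ T (r, f r, deriv f r) (1, deriv f r, deriv (deriv f) r)) :
    IsGQTG d Q := by
  refine ⟨2, fun s p => fderiv ℝ T (s, p 0, p 1) (1, p 1, p 2), contDiffOn_totalDerivative hT,
    fun I f hf r hr => ⟨?_, eulerLagrange_totalDerivative hT hf hr⟩⟩
  obtain ⟨h0, h1, h2⟩ := radialJet_two f r
  rw [hQ f r (hf.smooth.contDiffAt (hf.isOpen.mem_nhds hr)) (hf.ne_zero r hr) (hf.pos r hr)]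
  simp only [h0, h1, h2]

/-! ### The completing densities -/

open CurvTensor

/-- The sectional components of the Weyl tensor of a static and spherically symmetric metric, up to
a factor. -/
def weylShape (d : ℕ) : Fin (d + 2) → Fin (d + 2) → ℝ :=
  sssCurv ((d - 1) / (d + 1)) (-(d - 1) / (d * (d + 1))) (2 / (d * (d + 1)))

/-- The coefficient of `L` on the static and spherically symmetric ansatz once the Riemann tensor
is replaced by the Weyl tensor. -/
def weylCoeff (d : ℕ) (L : CurvInvariant) : ℝ := frameEval (diagCurv (weylShape d)) L ![]

theorem realizes_weyl {d n : ℕ} (hd : 1 ≤ d) {L : CurvInvariant} (hL : L.IsOfOrder n) :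
    Realizes d (substRiem (weyl d) L) (fun A B p => weylCoeff d L * sssWeyl A B p ^ n) := by
  refine ⟨NablaFree.substRiem (weyl_nablaFree d) hL.nablaFree, fun A B p => ?_⟩
  have h : (fun a b c e => frameEval (diagCurv (sssCurv (d := d) A B p)) (weyl d) ![a, b, c, e]) =
      fun a b c e => sssWeyl A B p * diagCurv (weylShape d) a b c e := by
    ext a b c e
    rw [hasDiag_weyl A B p hd]
    simp only [diagCurv, weylShape]
    ring
  rw [frameEval_substRiem, h, frameEval_smul _ _ hL, weylCoeff, mul_comm]

/-- An order-one scalar is linear in the curvature and unchanged by relabelling the frame, so it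
equals its value on the average over all relabellings. The average of the Weyl weights is constant
on pairs of distinct directions, and their total is the trace, which is zero; so the average
vanishes. -/
theorem weylCoeff_of_order_one {d : ℕ} (hd : 1 ≤ d) {L : CurvInvariant} (hL : L.IsOfOrder 1) :
    weylCoeff d L = 0 := by
  have hd0 : (d : ℝ) ≠ 0 := by positivity
  have hd1 : (d : ℝ) + 1 ≠ 0 := by positivity
  set K := weylShape d with hK
  set S : Fin (d + 2) → Fin (d + 2) → ℝ := fun a b => ∑ σ : Equiv.Perm (Fin (d + 2)), K (σ a) (σ b)
    with hS
  have hself : ∀ a, S a a = 0 := fun a => by simp [hS, hK, weylShape, sssCurv_self]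
  have htotal : ∑ b, ∑ a, S a b = 0 := by
    have h1 : ∑ b, ∑ a, S a b = ∑ σ : Equiv.Perm (Fin (d + 2)), ∑ b, ∑ a, K (σ a) (σ b) := by
      rw [Finset.sum_congr rfl fun b _ => Finset.sum_comm, Finset.sum_comm]
    rw [h1]
    refine Finset.sum_eq_zero fun σ _ => ?_
    have h2 : ∀ b, ∑ a, K (σ a) (σ b) = ∑ a, K a (σ b) := fun b =>
      Equiv.sum_comp σ fun a => K a (σ b)
    simp only [h2]
    rw [Equiv.sum_comp σ fun b => ∑ a, K a b, hK, weylShape, sum_sssCurv, sssScalar]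
    field_simp
    ring
  have hconst : ∀ a b a' b', a ≠ b → a' ≠ b' → S a b = S a' b' := by
    intro a b a' b' hab hab'
    -- The symmetric group is doubly transitive, and multiplying by `τ` only reorders the average.
    obtain ⟨τ, h1, h2⟩ := (MulAction.is_two_pretransitive_iff
      (G := Equiv.Perm (Fin (d + 2))) (α := Fin (d + 2))).1
      (Equiv.Perm.isMultiplyPretransitive _ 2) hab hab'
    rw [Equiv.Perm.smul_def] at h1 h2
    simp only [hS, ← h1, ← h2]
    exact (Equiv.sum_comp (Equiv.mulRight τ) fun σ => K (σ a) (σ b)).symm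
  have hzero : ∀ a b, S a b = 0 := by
    intro a b
    by_cases hab : a = b
    · rw [hab, hself]
    have h1 : ∀ a' b', S a' b' = if a' = b' then 0 else S a b := by
      intro a' b'
      split_ifs with h
      · rw [h, hself]
      · exact hconst _ _ _ _ h hab
    have h2 : ∀ a' b', S a' b' = S a b - if a' = b' then S a b else 0 := by
      intro a' b'
      rw [h1]
      split_ifs <;> ring
    have h3 : ∑ b', ∑ a', S a' b' = (d + 2) * ((d + 1) * S a b) := by
      rw [Finset.sum_congr rfl fun b' _ => Finset.sum_congr rfl fun a' _ => h2 a' b']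
      simp only [Finset.sum_sub_distrib, Finset.sum_const, Finset.sum_ite_eq', Finset.mem_univ,
        if_true, Finset.card_univ, Fintype.card_fin, nsmul_eq_mul]
      push_cast
      ring
    rw [htotal] at h3
    have h4 : (d : ℝ) + 2 ≠ 0 := by positivity
    simpa [h4, hd1] using h3.symm
  have hsum : (fun a b c e => ∑ σ ∈ (Finset.univ : Finset (Equiv.Perm (Fin (d + 2)))),
      diagCurv K (σ a) (σ b) (σ c) (σ e)) = fun a b c e => 0 * diagCurv K a b c e := by
    ext a b c e
    simp only [diagCurv, EmbeddingLike.apply_eq_iff_eq, ← Finset.sum_mul]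
    have := hzero a b
    simp only [hS] at this
    rw [this]; ring
  have h1 := frameEval_sum Finset.univ (fun (σ : Equiv.Perm (Fin (d + 2))) a b c e =>
    diagCurv K (σ a) (σ b) (σ c) (σ e)) hL ![]
  rw [hsum, frameEval_smul 0 _ hL] at h1
  have h2 : ∀ σ : Equiv.Perm (Fin (d + 2)),
      frameEval (fun a b c e => diagCurv K (σ a) (σ b) (σ c) (σ e)) L ![] = weylCoeff d L := by
    intro σ
    rw [frameEval_perm, weylCoeff]
    exact congrArg _ (Subsingleton.elim _ _)
  simp only [h2, Finset.sum_const, nsmul_eq_mul, pow_one, zero_mul] at h1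
  have h3 : ((Finset.univ : Finset (Equiv.Perm (Fin (d + 2)))).card : ℝ) ≠ 0 := by
    simp [Fintype.card_perm, Nat.factorial_ne_zero]
  simpa [h3] using h1.symm

/-- For `d = 1` the first two weights contain the factor `d - 1 = 0`, and the single spherical
direction spans no plane. -/
theorem weylCoeff_three_dim {n : ℕ} (hn : n ≠ 0) {L : CurvInvariant} (hL : L.IsOfOrder n) :
    weylCoeff 1 L = 0 := by
  have h : (diagCurv (weylShape 1)) = fun a b c e => 0 * diagCurv (weylShape 1) a b c e := by
    ext a b c e
    have : ∀ a b, weylShape 1 a b = 0 := by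
      intro a b
      fin_cases a <;> fin_cases b <;> simp [weylShape, sssCurv]
    simp [diagCurv, this]
  rw [weylCoeff, h, frameEval_smul 0 _ hL, zero_pow hn, zero_mul]

/-- The Weyl version plus `Q` agrees with `L` on every Ricci-flat metric, so the difference is
reducible with `V = 0`. -/
theorem isCompletable_of_realizes {d : ℕ} {L Q : CurvInvariant} (hL : L.NablaFree)
    (hQ : IsGQTG d (.add (substRiem (weyl d) L) Q)) (hv : VanishesOnRicciFlat d Q) :
    IsCompletable d L := by
  refine ⟨_, hQ, isReducible_of_vanishing fun g x hx => ?_⟩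
  have h : eval g (substRiem (weyl d) L) x ![] = eval g L x ![] :=
    eval_substRiem (eval_weyl hx) hL ![]
  simp only [CurvTensor.value, CurvTensor.sub, eval, h, hv g x hx]
  ring

theorem Realizes.isGQTG {d : ℕ} {Q : CurvInvariant} {P : ℝ → ℝ → ℝ → ℝ} (hQ : Realizes d Q P)
    {T : ℝ × ℝ × ℝ → ℝ} (hT : ContDiffOn ℝ ∞ T {q | 0 < q.1})
    (h : ∀ r p₀ p₁ p₂ : ℝ, 0 < r → r ^ d * P (-p₂ / 2) (-p₁ / (2 * r)) ((1 - p₀) / r ^ 2) =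
      fderiv ℝ T (r, p₀, p₁) (1, p₁, p₂)) : IsGQTG d Q :=
  isGQTG_of_totalDerivative hT fun f r hf hf0 hr => by
    rw [sssValue_eq_frameEval hQ.nablaFree hf hf0 hr.ne', hQ.frameEval_eq, h _ _ _ _ hr]

theorem isGQTG_of_const {d : ℕ} {Q : CurvInvariant} {c : ℝ} (hQ : Realizes d Q fun _ _ _ => c) :
    IsGQTG d Q := by
  -- `c r^d` is the derivative of `c r^(d+1) / (d+1)`.
  refine Realizes.isGQTG hQ (T := fun q => c * q.1 ^ (d + 1) / (d + 1))
    (by apply ContDiff.contDiffOn; fun_prop) fun r p₀ p₁ p₂ _ => ?_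
  have hd : (d : ℝ) + 1 ≠ 0 := by positivity
  have h1 : DifferentiableAt ℝ (fun q : ℝ × ℝ × ℝ => c * q.1 ^ (d + 1) / (d + 1)) (r, p₀, p₁) := by
    fun_prop
  rw [← h1.lineDeriv_eq_fderiv, lineDeriv]
  have h2 : HasDerivAt (fun t : ℝ => c * (r + t * 1) ^ (d + 1) / (d + 1))
      (c * ((d + 1 : ℕ) * (r + 0 * 1) ^ d * (1 * 1)) / (d + 1)) 0 :=
    (((((hasDerivAt_id (0 : ℝ)).mul_const 1).const_add r).pow (d + 1)).const_mul c).div_const _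
  refine Eq.trans ?_ h2.deriv.symm
  push_cast
  field_simp
  rw [add_zero, mul_comm]

/-- A function of `r, f, f'` whose total derivative is a density of order `k + 2`. -/
def boundaryTerm (d k : ℕ) (κ : ℝ) (q : ℝ × ℝ × ℝ) : ℝ :=
  κ * q.1 ^ (d + 1) *
    ((4 * (-q.2.2 / (2 * q.1)) + (d - 2) * ((1 - q.2.1) / q.1 ^ 2)) ^ (k + 1) *
      ((k + 2) * (d + 2) * ((1 - q.2.1) / q.1 ^ 2)
        - k * (4 * (-q.2.2 / (2 * q.1)) + (d - 2) * ((1 - q.2.1) / q.1 ^ 2))))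

theorem contDiffOn_boundaryTerm (d k : ℕ) (κ : ℝ) :
    ContDiffOn ℝ ∞ (boundaryTerm d k κ) {q | 0 < q.1} := by
  have h1 : ContDiffOn ℝ ∞ (fun q : ℝ × ℝ × ℝ => -q.2.2 / (2 * q.1)) {q | 0 < q.1} :=
    ContDiffOn.div (by fun_prop) (by fun_prop) fun q hq => mul_ne_zero two_ne_zero (ne_of_gt hq)
  have h2 : ContDiffOn ℝ ∞ (fun q : ℝ × ℝ × ℝ => (1 - q.2.1) / q.1 ^ 2) {q | 0 < q.1} :=
    ContDiffOn.div (by fun_prop) (by fun_prop) fun q hq => pow_ne_zero 2 (ne_of_gt hq)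
  unfold boundaryTerm
  fun_prop

/-- Along a profile, `B' = (A - B)/r` and `p' = 2(B - p)/r`, so the derivative of `boundaryTerm` is
`r^d (R - 2W)^k` times a quadratic form in `A, B, p`, linear in `A`. With the coefficients in
`boundaryTerm` this form has no `RZ` or `WZ` term, and its `RW` coefficient is `2k` times that of
`R²`, which is the shape of `isRicciRealized_density`. -/
theorem fderiv_boundaryTerm {d : ℕ} (hd : 2 ≤ d) (k : ℕ) (κ : ℝ) {r : ℝ} (hr : 0 < r)
    (p₀ p₁ p₂ : ℝ) {A B p : ℝ} (hA : A = -p₂ / 2) (hB : B = -p₁ / (2 * r))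
    (hp : p = (1 - p₀) / r ^ 2) :
    fderiv ℝ (boundaryTerm d k (κ * (d + 1) ^ k)) (r, p₀, p₁) (1, p₁, p₂) =
      r ^ d * (κ * ((sssScalar d A B p - 2 * sssWeyl A B p) ^ k *
        (8 * (k + 1) * ((k + 1) * d + k + 2) / (d * (d + 1)) * sssWeyl A B p ^ 2
      + (-8 * (k + 1) * (k + 2) / d) * sssTraceless d A B p ^ 2
      + 2 / (d + 1) * (sssScalar d A B p ^ 2 + 2 * k * sssScalar d A B p * sssWeyl A B p)))) := by
  have hopen : IsOpen {q : ℝ × ℝ × ℝ | 0 < q.1} := isOpen_lt continuous_const continuous_fst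
  have hdiff : DifferentiableAt ℝ (boundaryTerm d k (κ * (d + 1) ^ k)) (r, p₀, p₁) :=
    ((contDiffOn_boundaryTerm d k _).contDiffAt (hopen.mem_nhds hr)).differentiableAt (by simp)
  have hd0 : (d : ℝ) ≠ 0 := by positivity
  have hd1 : (d : ℝ) + 1 ≠ 0 := by positivity
  have hr0 := hr.ne'
  have hρ : HasDerivAt (fun t : ℝ => r + t * 1) 1 0 := by
    simpa using ((hasDerivAt_id (0 : ℝ)).mul_const 1).const_add r
  have hβ : HasDerivAt (fun t : ℝ => -(p₁ + t * p₂) / (2 * (r + t * 1))) ((A - B) / r) 0 := by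
    have h1 : HasDerivAt (fun t : ℝ => -(p₁ + t * p₂)) (-p₂) 0 := by
      simpa using (((hasDerivAt_id (0 : ℝ)).mul_const p₂).const_add p₁).fun_neg
    refine (h1.div (hρ.const_mul 2) (by simpa using hr0)).congr_deriv ?_
    rw [hA, hB]
    simp only [zero_mul, add_zero]
    field_simp
  have hψ : HasDerivAt (fun t : ℝ => (1 - (p₀ + t * p₁)) / (r + t * 1) ^ 2) (2 * (B - p) / r) 0 := by
    have h1 : HasDerivAt (fun t : ℝ => 1 - (p₀ + t * p₁)) (-p₁) 0 := by
      simpa using (((hasDerivAt_id (0 : ℝ)).mul_const p₁).const_add p₀).const_sub 1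
    refine (h1.fun_div (hρ.fun_pow 2) (by simpa using hr0)).congr_deriv ?_
    rw [hB, hp]
    simp only [zero_mul, add_zero]
    field_simp
    ring
  -- The differential is computed along the line `(r + t, p₀ + t p₁, p₁ + t p₂)`.
  rw [← hdiff.lineDeriv_eq_fderiv, lineDeriv]
  have hw := (hβ.const_mul 4).fun_add (hψ.const_mul ((d : ℝ) - 2))
  have hT := ((hρ.fun_pow (d + 1)).const_mul (κ * ((d : ℝ) + 1) ^ k)).fun_mul
    ((hw.fun_pow (k + 1)).fun_mul
      ((hψ.const_mul (((k : ℝ) + 2) * (d + 2))).fun_sub (hw.const_mul (k : ℝ))))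
  refine hT.deriv.trans ?_
  simp only [zero_mul, add_zero, ← hB, ← hp, Nat.add_sub_cancel]
  have hR : sssScalar d A B p - 2 * sssWeyl A B p = (d + 1) * (4 * B + (d - 2) * p) := by
    simp only [sssScalar, sssWeyl]; ring
  rw [hR, mul_pow]
  simp only [sssScalar, sssWeyl, sssTraceless]
  push_cast
  rw [pow_succ _ k, pow_succ r d]
  -- With the symbolic powers abstracted, a rational identity in finitely many variables remains.
  generalize (4 * B + ((d : ℝ) - 2) * p) ^ k = X
  generalize r ^ d = Y
  generalize ((d : ℝ) + 1) ^ k = Z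
  field_simp
  ring

theorem isRicciRealized_zero (d : ℕ) : IsRicciRealized d fun _ _ _ => 0 :=
  ((isRicciRealized_scalar d).smul 0).congr fun _ _ _ => zero_mul _

theorem isCompletable_of_const {d : ℕ} {L : CurvInvariant} (hL : L.NablaFree) {c : ℝ}
    (h : Realizes d (substRiem (weyl d) L) fun _ _ _ => c) : IsCompletable d L := by
  obtain ⟨M, hM, hv⟩ := isRicciRealized_zero d
  exact isCompletable_of_realizes hL (isGQTG_of_const (h.add hM)) hv

/-- Every curvature invariant `L` of order `n` without covariant derivatives is completable. On
Ricci-flat metrics `L` agrees with its Weyl part, which is a multiple of the `n`-th power of the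
single Weyl component on the static and spherically symmetric ansatz. Unless that multiple is zero
or `n = 0`, invariants with a Ricci factor turn this power into a total derivative. -/
theorem isCompletable_of_isOfOrder {d n : ℕ} (hd : 1 ≤ d) {L : CurvInvariant}
    (hL : L.IsOfOrder n) : IsCompletable d L := by
  have hW := realizes_weyl hd hL
  by_cases hc : weylCoeff d L = 0
  · simp only [hc, zero_mul] at hW
    exact isCompletable_of_const hL.nablaFree hW
  rcases n with _ | _ | k
  · simp only [pow_zero, mul_one] at hW
    exact isCompletable_of_const hL.nablaFree hW
  · exact absurd (weylCoeff_of_order_one hd hL) hc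
  have hd2 : 2 ≤ d := by
    by_contra h
    obtain rfl : d = 1 := by omega
    exact hc (weylCoeff_three_dim (by omega) hL)
  have hd0 : (d : ℝ) ≠ 0 := by positivity
  have hd1 : (d : ℝ) + 1 ≠ 0 := by positivity
  set a : ℝ := 8 * (k + 1) * ((k + 1) * d + k + 2) / (d * (d + 1)) with ha
  have hane : a ≠ 0 := by positivity
  have hpow : ((-2 : ℝ)) ^ k ≠ 0 := pow_ne_zero k (by norm_num)
  -- The choice of `κ` makes the pure Weyl term subtracted in `isRicciRealized_density` cancel the
  -- Weyl version of `L`, leaving only the total derivative.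
  set κ : ℝ := weylCoeff d L / (a * (-2) ^ k) with hκ
  obtain ⟨M, hM, hv⟩ := (isRicciRealized_density hd2 k a (-8 * (k + 1) * (k + 2) / d)
    (2 / (d + 1))).smul κ
  refine isCompletable_of_realizes hL.nablaFree (Realizes.isGQTG (hW.add hM)
    (contDiffOn_boundaryTerm d k (κ * (d + 1) ^ k)) fun r p₀ p₁ p₂ hr => ?_) hv
  rw [fderiv_boundaryTerm hd2 k κ hr p₀ p₁ p₂ rfl rfl rfl, ← ha]
  have hcκ : weylCoeff d L = κ * (a * (-2) ^ k) := by
    rw [hκ, div_mul_cancel₀ _ (mul_ne_zero hane hpow)]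
  rw [hcκ]
  ring

end HigherCurvature

end

/-- The completability of `L` does not depend on `L₀`: a completing density exists at every order,
whether or not `L₀` has a nonzero Weyl part on the static and spherically symmetric ansatz. -/
theorem theorem2 (d n : ℕ) (hd : 1 ≤ d)
    (L₀ : HigherCurvature.CurvInvariant)
    (hL₀_order : L₀.IsOfOrder n)
    (hL₀_irreducible : HigherCurvature.IsIrreducible (d + 2) L₀)
    (hL₀_completable : HigherCurvature.IsCompletable d L₀)
    (hL₀_sss : ¬ HigherCurvature.VanishesOnSSS d L₀) :
    ∀ L : HigherCurvature.CurvInvariant, L.IsOfOrder n →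
      HigherCurvature.IsIrreducible (d + 2) L → HigherCurvature.IsCompletable d L :=
  fun _ hL _ => HigherCurvature.isCompletable_of_isOfOrder hd hL
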